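/- Let $p$ be a prime number and let $K$ be a finite extension of $\mathbf{Q}_p$, with absolute ramification index $e_K$ and residue field $k$. Let $L$ be a finite Galois extension of $K$ with group $G=\operatorname{Gal}(L|K)$ and inertia subgroup $T\subset G$ (the subgroup acting trivially on the residue field of $L$). Suppose that $L|K$ is tamely ramified (its ramification index is prime to $p$) and split, in the sense that the short exact sequence of groups $1\to T\to G\to G/T\to 1$ has a section which is a group homomorphism. Suppose also that the $p$-torsion subgroup ${}_pL^\times=\{x\in L^\times : x^p=1\}$ has order $p$. Let $U_L^1$ be the group of units of the ring of integers of $L$ congruent to $1$ modulo the maximal ideal, and let $\bar U_L^1$ be its image in $L^\times/L^{\times p}$. Then there are isomorphisms of $\mathbf{F}_p[G]$-modules $$\bar U_L^1\;\cong\;{}_pL^\times\oplus k[G]^{e_K}\;\cong\;{}_pL^\times\oplus \mathbf{F}_p[G]^{[K:\mathbf{Q}_p]},$$ where $G$ acts on ${}_pL^\times$ and on $L^\times/L^{\times p}$ through its action on $L$, and $\mathbf{F}_p[G]$ acts on the group algebra $k[G]$ by left multiplication through the inclusion $\mathbf{F}_p[G]\subset k[G]$. -/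

import Mathlib

open IsLocalRing
open scoped MonoidAlgebra

noncomputable section

namespace LittleGalois

/-! ### Rings of integers of finite extensions of `ℚ_[p]` -/

section Integers

variable (p : ℕ) [Fact p.Prime] (E : Type*) [Field E] [Algebra ℚ_[p] E]

/-- `x` is integral over `ℤ_[p]`. -/
def IsPadicIntegral (x : E) : Prop :=
  ((algebraMap ℚ_[p] E).comp (algebraMap ℤ_[p] ℚ_[p])).IsIntegralElem x

variable {E} [FiniteDimensional ℚ_[p] E]

lemma isPadicIntegral_iff (x : E) : IsPadicIntegral p E x ↔ spectralNorm ℚ_[p] E x ≤ 1 := by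
  let : Algebra ℤ_[p] E := ((algebraMap ℚ_[p] E).comp (algebraMap ℤ_[p] ℚ_[p])).toAlgebra
  have : IsScalarTower ℤ_[p] ℚ_[p] E := IsScalarTower.of_algebraMap_eq (fun _ => rfl)
  have hx : IsIntegral ℚ_[p] x := Algebra.IsIntegral.isIntegral x
  change IsIntegral ℤ_[p] x ↔ spectralValue (minpoly ℚ_[p] x) ≤ 1
  rw [spectralValue_le_one_iff (minpoly.monic hx)]
  constructor
  · intro h n
    rw [minpoly.isIntegrallyClosed_eq_field_fractions' ℚ_[p] h, Polynomial.coeff_map]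
    exact PadicInt.norm_le_one _
  · intro h
    have hl : minpoly ℚ_[p] x ∈ Polynomial.lifts (algebraMap ℤ_[p] ℚ_[p]) := by
      rw [Polynomial.lifts_iff_coeff_lifts]
      intro n
      exact ⟨⟨_, h n⟩, rfl⟩
    obtain ⟨q, hq, -, hm⟩ := Polynomial.lifts_and_degree_eq_and_monic hl (minpoly.monic hx)
    refine ⟨q, hm, ?_⟩
    have := minpoly.aeval ℚ_[p] x
    rw [← hq, Polynomial.aeval_map_algebraMap] at this
    exact this

variable (E)

/-- The ring of integers of a finite extension `E` of `ℚ_[p]`: the elements of `E` that are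
integral over `ℤ_[p]`. It is a valuation ring of `E`. -/
def integers : ValuationSubring E where
  carrier := {x | IsPadicIntegral p E x}
  mul_mem' {_ _} ha hb := RingHom.IsIntegralElem.mul _ ha hb
  one_mem' := RingHom.isIntegralElem_one _
  add_mem' {_ _} ha hb := RingHom.IsIntegralElem.add _ ha hb
  zero_mem' := RingHom.isIntegralElem_zero _
  neg_mem' {_} ha := RingHom.IsIntegralElem.neg _ ha
  mem_or_inv_mem' x := by
    simp only [Set.mem_ofPred_eq, isPadicIntegral_iff]
    by_cases hx : x = 0
    · left; subst hx; rw [spectralNorm_zero]; exact zero_le_one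
    by_contra! h
    have hmul : spectralNorm ℚ_[p] E x * spectralNorm ℚ_[p] E x⁻¹ = 1 := by
      rw [← spectralMulAlgNorm_def, ← spectralMulAlgNorm_def, ← map_mul, mul_inv_cancel₀ hx,
        map_one]
    have := one_lt_mul_of_lt_of_le h.1 h.2.le
    exact absurd hmul this.ne'

lemma mem_integers {x : E} : x ∈ integers p E ↔ IsPadicIntegral p E x := Iff.rfl

/-- The residue field of a finite extension of `ℚ_[p]`. -/
abbrev residueField : Type _ := ResidueField (integers p E)

instance : CharP (residueField p E) p := by
  refine (CharP.charP_iff_prime_eq_zero Fact.out).mpr ?_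
  rw [← map_natCast (residue (integers p E)), residue_eq_zero_iff, mem_maximalIdeal]
  rintro ⟨u, hu⟩
  have h1 : spectralNorm ℚ_[p] E (((u⁻¹ : (integers p E)ˣ) : integers p E) : E) ≤ 1 :=
    (isPadicIntegral_iff p _).mp (u⁻¹ : (integers p E)ˣ).1.2
  have h2 : (p : E) * (((u⁻¹ : (integers p E)ˣ) : integers p E) : E) = 1 := by
    have := congrArg (Subtype.val) (u.mul_inv)
    rw [hu] at this
    simpa using this
  have h3 : spectralNorm ℚ_[p] E (p : E) < 1 := by
    have : (p : E) = algebraMap ℚ_[p] E (p : ℚ_[p]) := by simp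
    rw [this, spectralNorm_extends]
    exact Padic.norm_p_lt_one
  have h4 : spectralNorm ℚ_[p] E (p : E) *
      spectralNorm ℚ_[p] E (((u⁻¹ : (integers p E)ˣ) : integers p E) : E) = 1 := by
    rw [← spectralMulAlgNorm_def, ← spectralMulAlgNorm_def, ← map_mul, h2, map_one]
  have h5 := mul_lt_one_of_nonneg_of_lt_one_left (spectralNorm_nonneg _) h3 h1
  exact absurd h4 h5.ne

instance : Algebra (ZMod p) (residueField p E) := ZMod.algebra _ p

end Integers

/-! ### Ramification -/

section Ramification

variable (p : ℕ) [Fact p.Prime]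
  (F : Type*) [Field F] [Algebra ℚ_[p] F] [FiniteDimensional ℚ_[p] F]
  (E : Type*) [Field E] [Algebra ℚ_[p] E] [FiniteDimensional ℚ_[p] E]
  [Algebra F E] [IsScalarTower ℚ_[p] F E]

/-- The inclusion of the ring of integers of `F` into that of `E`. -/
def integersMap : integers p F →+* integers p E :=
  ((algebraMap F E).comp (integers p F).subtype).codRestrict (integers p E) fun x => by
    have h : IsPadicIntegral p F (x : F) := x.2
    obtain ⟨q, hq, hx⟩ := h
    refine ⟨q, hq, ?_⟩
    have := congrArg (algebraMap F E) hx
    rw [Polynomial.hom_eval₂, ← RingHom.comp_assoc, ← IsScalarTower.algebraMap_eq, map_zero] at this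
    exact this

/-- The ramification index of `E` over `F`. The absolute ramification index of `E` is
`ramificationIndex p ℚ_[p] E`. -/
def ramificationIndex : ℕ :=
  letI : Algebra (integers p F) (integers p E) := (integersMap p F E).toAlgebra
  (maximalIdeal (integers p F)).ramificationIdx' (maximalIdeal (integers p E))

/-- `E` is tamely ramified over `F`: the ramification index is prime to `p`
(residual extensions are finite extensions of finite fields, hence separable). -/
def IsTamelyRamified : Prop := ¬ p ∣ ramificationIndex p F E

/-- The Galois group acts on the ring of integers. -/
instance : MulSemiringAction Gal(E/F) (integers p E) where
  smul g x := ⟨g (x : E), by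
    obtain ⟨q, hq, hx⟩ := (show IsPadicIntegral p E (x : E) from x.2)
    refine ⟨q, hq, ?_⟩
    have := congrArg (g.restrictScalars ℚ_[p] : E ≃ₐ[ℚ_[p]] E).toRingEquiv.toRingHom hx
    rw [Polynomial.hom_eval₂, map_zero, ← RingHom.comp_assoc,
      show (g.restrictScalars ℚ_[p] : E ≃ₐ[ℚ_[p]] E).toRingEquiv.toRingHom.comp
        (algebraMap ℚ_[p] E) = algebraMap ℚ_[p] E from
          RingHom.ext fun a => (g.restrictScalars ℚ_[p] : E ≃ₐ[ℚ_[p]] E).commutes a] at this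
    exact this⟩
  one_smul _ := rfl
  mul_smul _ _ _ := rfl
  smul_zero g := Subtype.ext (map_zero g)
  smul_add g x y := Subtype.ext (map_add g (x : E) (y : E))
  smul_one g := Subtype.ext (map_one g)
  smul_mul g x y := Subtype.ext (map_mul g (x : E) (y : E))

/-- The inertia subgroup: the automorphisms acting trivially on the residue field. -/
abbrev inertiaSubgroup : Subgroup Gal(E/F) :=
  (MulSemiringAction.toRingAut Gal(E/F) (residueField p E)).ker

/-- `E` is split over `F`: the exact sequence `1 → T → G → G/T → 1`, with `G` the Galois group and
`T` the inertia subgroup, has a section (which is a group homomorphism). -/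
def IsSplit : Prop :=
  ∃ s : Gal(E/F) ⧸ inertiaSubgroup p F E →* Gal(E/F),
    (QuotientGroup.mk' (inertiaSubgroup p F E)).comp s = MonoidHom.id _

end Ramification

/-! ### Modules over `𝔽_p[G]` -/

section Modules

/-- The representation over `ZMod p` given by an action of `G` on a commutative group `A`
whose additive version is a `ZMod p`-vector space. Its `asModule` is the corresponding
module over the group algebra. -/
def zmodRep (p : ℕ) (G A : Type*) [Group G] [CommGroup A] [MulDistribMulAction G A]
    [Module (ZMod p) (Additive A)] : Representation (ZMod p) G (Additive A) where
  toFun g := (MonoidHom.toAdditive (MulDistribMulAction.toMonoidHom A g)).toZModLinearMap p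
  map_one' := by ext a; exact congrArg Additive.ofMul (one_smul G a.toMul)
  map_mul' g h := by ext a; exact congrArg Additive.ofMul (mul_smul g h a.toMul)

variable (p : ℕ) [Fact p.Prime]
  (K : Type*) [Field K]
  (L : Type*) [Field L] [Algebra K L]

/-- The `p`-torsion subgroup of the multiplicative group of `L`. -/
def pTorsion : Subgroup Lˣ := (powMonoidHom p : Lˣ →* Lˣ).ker

instance : Module (ZMod p) (Additive (pTorsion p L)) :=
  AddCommGroup.zmodModule fun x => by
    refine congrArg Additive.ofMul (Subtype.ext ?_ : x.toMul ^ p = 1)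
    exact x.toMul.2

instance : MulDistribMulAction Gal(L/K) (pTorsion p L) where
  smul g x := ⟨g • (x : Lˣ), by
    have hx : (x : Lˣ) ^ p = 1 := x.2
    change (g • (x : Lˣ)) ^ p = 1
    rw [← smul_pow', hx, smul_one]⟩
  one_smul x := Subtype.ext (one_smul _ (x : Lˣ))
  mul_smul g h x := Subtype.ext (mul_smul g h (x : Lˣ))
  smul_mul g x y := Subtype.ext (smul_mul' g (x : Lˣ) (y : Lˣ))
  smul_one g := Subtype.ext (smul_one g)

/-- The quotient of the multiplicative group of `L` by the subgroup of `p`-th powers. -/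
abbrev UnitsModPow : Type _ := Lˣ ⧸ (powMonoidHom p : Lˣ →* Lˣ).range

instance : MulDistribMulAction Gal(L/K) (UnitsModPow p L) where
  smul g := QuotientGroup.map _ _ (MulDistribMulAction.toMonoidHom Lˣ g) (by
    rintro _ ⟨y, rfl⟩
    exact ⟨g • y, (smul_pow' g y p).symm⟩)
  one_smul x := by
    induction x using QuotientGroup.induction_on with
    | H z => exact congrArg _ (one_smul _ z)
  mul_smul g h x := by
    induction x using QuotientGroup.induction_on with
    | H z => exact congrArg _ (mul_smul g h z)
  smul_mul g x y := map_mul _ x y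
  smul_one g := map_one _

variable [Algebra ℚ_[p] L] [FiniteDimensional ℚ_[p] L]

/-- The image in `Lˣ / (Lˣ)^p` of the group of principal units of `L`
(the units congruent to `1` modulo the maximal ideal). -/
def principalUnitsBar : Subgroup (UnitsModPow p L) :=
  (integers p L).principalUnitGroup.map (QuotientGroup.mk' _)

instance : Module (ZMod p) (Additive (principalUnitsBar p L)) :=
  AddCommGroup.zmodModule fun (x : Additive (principalUnitsBar p L)) => by
    have hx : x.toMul ^ p = 1 := by
      obtain ⟨z, -, hz⟩ := x.toMul.2
      refine Subtype.ext ?_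
      change (x.toMul : UnitsModPow p L) ^ p = 1
      rw [← hz]
      exact (QuotientGroup.eq_one_iff _).mpr ⟨z, rfl⟩
    exact congrArg Additive.ofMul hx

variable [Algebra ℚ_[p] K] [IsScalarTower ℚ_[p] K L]

lemma smul_mem_principalUnitGroup (g : Gal(L/K)) {z : Lˣ}
    (hz : z ∈ (integers p L).principalUnitGroup) :
    g • z ∈ (integers p L).principalUnitGroup := by
  have key : ∀ y : L, (integers p L).valuation y < 1 ↔ y = 0 ∨ y⁻¹ ∉ integers p L := by
    intro y
    rw [← ValuationSubring.valuation_le_one_iff, map_inv₀]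
    by_cases hy : y = 0
    · simp [hy]
    · have : 0 < (integers p L).valuation y := by
        rw [zero_lt_iff]; simpa using hy
      simp [hy, inv_le_one₀ this]
  have hinv : ∀ y : L, g y ∈ integers p L → y ∈ integers p L := by
    intro y hy
    have h : g⁻¹ (g y) ∈ integers p L := (g⁻¹ • (⟨g y, hy⟩ : integers p L)).2
    rwa [← AlgEquiv.mul_apply, inv_mul_cancel, AlgEquiv.one_apply] at h
  rw [ValuationSubring.mem_principalUnitGroup_iff, key] at hz ⊢
  have h1 : ((g • z : Lˣ) : L) - 1 = g ((z : L) - 1) := by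
    rw [map_sub, map_one]; rfl
  rw [h1, ← map_inv₀]
  rcases hz with hz | hz
  · left; rw [hz, map_zero]
  · right; exact fun h => hz (hinv _ h)

instance : MulDistribMulAction Gal(L/K) (principalUnitsBar p L) where
  smul g x := ⟨g • (x : UnitsModPow p L), by
    obtain ⟨_, z, hz, rfl⟩ := x
    exact ⟨g • z, smul_mem_principalUnitGroup p K L g hz, rfl⟩⟩
  one_smul x := Subtype.ext (one_smul _ (x : UnitsModPow p L))
  mul_smul g h x := Subtype.ext (mul_smul g h (x : UnitsModPow p L))
  smul_mul g x y := Subtype.ext (smul_mul' g (x : UnitsModPow p L) (y : UnitsModPow p L))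
  smul_one g := Subtype.ext (smul_one g)

/-- The `𝔽_p[G]`-module given by the `p`-torsion of the multiplicative group of `L`. -/
abbrev TorsionModule : Type _ := (zmodRep p Gal(L/K) (pTorsion p L)).asModule

/-- The `𝔽_p[G]`-module given by the image of the principal units in `Lˣ / (Lˣ)^p`. -/
abbrev PrincipalUnitsModule : Type _ := (zmodRep p Gal(L/K) (principalUnitsBar p L)).asModule

variable [FiniteDimensional ℚ_[p] K] in
/-- The group algebra of `G` over the residue field `k` as an `𝔽_p[G]`-module, through the ring
homomorphism `𝔽_p[G] → k[G]` induced by `𝔽_p → k`. -/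
instance (G : Type*) [Group G] : Module (ZMod p)[G] (residueField p K)[G] :=
  Module.compHom _ (MonoidAlgebra.mapRingHom G (algebraMap (ZMod p) (residueField p K)))

end Modules

end LittleGalois

end

noncomputable section

namespace LittleGalois

/-! Let `B` be the ring of integers of `L`, `l` its residue field, `ϖ` a uniformizer, `ζ ∈ L` a
primitive `p`-th root of unity, `e = v(ζ - 1)` and `d = |T|`. Then `(p - 1) e = v(p) = e_K d`. The
image of the principal units is filtered by the levels `ϖ ^ i`, and its graded pieces are read off
from `(1 + y) ^ p = 1 + y ^ p + p y S(y)`.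

The `p`-th power of a unit of exact level `j < e` has exact level `p j`, and its leading coefficient
is the `p`-th power of the original one. Hence for `0 < i < p e` the piece of level `i` is zero if
`p ∣ i`, because `l` is perfect, and is all of `ϖ ^ i B / ϖ ^ (i + 1) B` otherwise. At level `p e`,
the leading coefficient of `(1 + (ζ - 1) z) ^ p`, relative to `(ζ - 1) ^ p`, is `z ^ p - z`. By
Hensel's lemma and additive Hilbert 90, the trace identifies what remains with `𝔽_p`, on which `G`
acts as on `ζ`: this is the summand `ₚLˣ` (`nonempty_imageFiltration_equiv`).

The piece of level `i` is `l` with the Galois action twisted by `χ ^ i`, where `χ g = g ϖ / ϖ`.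
Splitness allows `ϖ` to be fixed by the section, and tameness makes `χ` modulo `ϖ` faithful on `T`.
A normal basis and a Vandermonde determinant then identify `k[G]` with any `d` consecutive pieces
(`exists_block_equiv`). So every piece is projective over `𝔽_p[G]` and the filtration splits
(`nonempty_imageFiltration_equiv_prod_pi`).

Frobenius identifies the pieces of levels `i` and `p i`. The levels below `p e` prime to `p` can
therefore be moved into `[e, p e)`, an interval of `e_K d` integers, which is cut into `e_K` blocks,
each isomorphic to `k[G]`. The second isomorphism comes from a basis of `k` over `𝔽_p` and `e_K [k :
𝔽_p] = [K : ℚ_p]`. -/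

lemma charZero_of_padic (p : ℕ) [Fact p.Prime] (E : Type*) [Field E] [Algebra ℚ_[p] E] :
    CharZero E :=
  charZero_of_injective_algebraMap (algebraMap ℚ_[p] E).injective

lemma finiteDimensional_of_padic (p : ℕ) [Fact p.Prime] (F : Type*) [Field F] [Algebra ℚ_[p] F]
    (E : Type*) [Field E] [Algebra ℚ_[p] E] [FiniteDimensional ℚ_[p] E]
    [Algebra F E] [IsScalarTower ℚ_[p] F E] : FiniteDimensional F E :=
  FiniteDimensional.right ℚ_[p] F E

/-! ### Rings of integers as discrete valuation rings. -/

section Integers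

variable (p : ℕ) [Fact p.Prime] (E : Type*) [Field E] [Algebra ℚ_[p] E]

/-- The structure of `ℤ_[p]`-algebra on an extension of `ℚ_[p]`. -/
abbrev padicIntAlgebra : Algebra ℤ_[p] E :=
  ((algebraMap ℚ_[p] E).comp (algebraMap ℤ_[p] ℚ_[p])).toAlgebra

variable [FiniteDimensional ℚ_[p] E]

/-- The structure of `ℤ_[p]`-algebra on the ring of integers. -/
abbrev integersPadicIntAlgebra : Algebra ℤ_[p] (integers p E) :=
  (((algebraMap ℚ_[p] E).comp (algebraMap ℤ_[p] ℚ_[p])).codRestrict (integers p E)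
    fun x => RingHom.isIntegralElem_map _ (x := x)).toAlgebra

lemma isIntegralClosure_padicInt :
    let := padicIntAlgebra p E
    let := integersPadicIntAlgebra p E
    IsIntegralClosure (integers p E) ℤ_[p] E :=
  let := padicIntAlgebra p E
  let := integersPadicIntAlgebra p E
  { algebraMap_injective := Subtype.val_injective
    isIntegral_iff := fun {x} => ⟨fun h => ⟨⟨x, h⟩, rfl⟩, by rintro ⟨y, rfl⟩; exact y.2⟩ }

lemma natCast_mem_maximalIdeal : (p : integers p E) ∈ maximalIdeal (integers p E) := by
  rw [← residue_eq_zero_iff, map_natCast]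
  exact CharP.cast_eq_zero _ p

instance : IsDiscreteValuationRing (integers p E) := by
  let := padicIntAlgebra p E
  let := integersPadicIntAlgebra p E
  have : IsScalarTower ℤ_[p] ℚ_[p] E := IsScalarTower.of_algebraMap_eq (fun _ => rfl)
  have : IsScalarTower ℤ_[p] (integers p E) E := IsScalarTower.of_algebraMap_eq (fun _ => rfl)
  have := isIntegralClosure_padicInt p E
  have hD : IsDedekindDomain (integers p E) :=
    IsIntegralClosure.isDedekindDomain ℤ_[p] ℚ_[p] E (integers p E)
  have hF : ¬ IsField (integers p E) := by
    rw [isField_iff_maximalIdeal_eq]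
    intro h
    have := natCast_mem_maximalIdeal p E
    rw [h, Ideal.mem_bot] at this
    have h2 := congrArg Subtype.val this
    have := charZero_of_padic p E
    exact (Fact.out : p.Prime).ne_zero (by exact_mod_cast h2)
  exact ((IsDiscreteValuationRing.TFAE _ hF).out 0 2).mpr hD

/-- The ring `ℤ_[p]` is the ring of integers of `ℚ_[p]`. -/
def padicIntEquivIntegers : ℤ_[p] ≃+* integers p ℚ_[p] where
  toFun x := ⟨x, RingHom.isIntegralElem_map (algebraMap ℤ_[p] ℚ_[p]) (x := x)⟩
  invFun x := ⟨x, by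
    have := (isPadicIntegral_iff p (x : ℚ_[p])).mp x.2
    rwa [show (x : ℚ_[p]) = algebraMap ℚ_[p] ℚ_[p] (x : ℚ_[p]) from rfl, spectralNorm_extends]
      at this⟩
  left_inv _ := rfl
  right_inv _ := rfl
  map_mul' _ _ := rfl
  map_add' _ _ := rfl

lemma card_residueField_padic : Nat.card (residueField p ℚ_[p]) = p := by
  rw [← Nat.card_congr (ResidueField.mapEquiv (padicIntEquivIntegers p)).toEquiv,
    Nat.card_congr (PadicInt.residueField (p := p)).toEquiv, Nat.card_zmod]

end Integers

/-! ### Ramification and residue degrees in an extension. -/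

section Extension

variable (p : ℕ) [Fact p.Prime]
  (F : Type*) [Field F] [Algebra ℚ_[p] F] [FiniteDimensional ℚ_[p] F]
  (E : Type*) [Field E] [Algebra ℚ_[p] E] [FiniteDimensional ℚ_[p] E]
  [Algebra F E] [IsScalarTower ℚ_[p] F E]

/-- The ring of integers of `E` as an algebra over that of `F`. -/
abbrev integersAlgebra : Algebra (integers p F) (integers p E) := (integersMap p F E).toAlgebra

attribute [local instance] integersAlgebra

lemma integers_isScalarTower : IsScalarTower (integers p F) (integers p E) E :=
  IsScalarTower.of_algebraMap_eq (fun _ => rfl)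

lemma integers_isIntegralClosure : IsIntegralClosure (integers p E) (integers p F) E where
  algebraMap_injective := Subtype.val_injective
  isIntegral_iff := fun {x} => by
    constructor
    · intro h
      have : x ∈ integers p E := by
        have h2 : IsIntegral (integers p E) x := by
          have := integers_isScalarTower p F E
          exact h.tower_top
        obtain ⟨y, hy⟩ := (IsIntegrallyClosed.isIntegral_iff (R := integers p E)).mp h2
        rw [← hy]; exact y.2
      exact ⟨⟨x, this⟩, rfl⟩
    · rintro ⟨y, rfl⟩
      obtain ⟨q, hq, hx⟩ := (show IsPadicIntegral p E (y : E) from y.2)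
      let := integersPadicIntAlgebra p F
      refine ⟨q.map (algebraMap ℤ_[p] (integers p F)), hq.map _, ?_⟩
      rw [Polynomial.eval₂_map, show (algebraMap (integers p F) E).comp
        (algebraMap ℤ_[p] (integers p F)) =
          (algebraMap ℚ_[p] E).comp (algebraMap ℤ_[p] ℚ_[p]) from
        RingHom.ext fun a => (IsScalarTower.algebraMap_apply ℚ_[p] F E _).symm]
      exact hx

lemma integers_finite : Module.Finite (integers p F) (integers p E) := by
  have := integers_isScalarTower p F E
  have := integers_isIntegralClosure p F E
  have := charZero_of_padic p F
  have := finiteDimensional_of_padic p F E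
  exact IsIntegralClosure.finite (integers p F) F E (integers p E)

lemma integers_isTorsionFree : Module.IsTorsionFree (integers p F) (integers p E) := by
  rw [Module.isTorsionFree_iff_algebraMap_injective]
  intro x y h
  exact Subtype.val_injective ((algebraMap F E).injective (congrArg Subtype.val h))

lemma integers_liesOver :
    (maximalIdeal (integers p E)).LiesOver (maximalIdeal (integers p F)) := by
  have := integers_finite p F E
  exact ⟨(eq_maximalIdeal (Ideal.isMaximal_comap_of_isIntegral_of_isMaximal _)).symm⟩

instance isLocalHom_integersMap : IsLocalHom (integersMap p F E) := by
  refine ((local_hom_TFAE (integersMap p F E)).out 0 4).mpr ?_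
  exact (integers_liesOver p F E).over.symm

lemma integers_finrank :
    Module.finrank (integers p F) (integers p E) = Module.finrank F E := by
  have := integers_isScalarTower p F E
  have := integers_isIntegralClosure p F E
  have := charZero_of_padic p F
  have := finiteDimensional_of_padic p F E
  have := integers_isTorsionFree p F E
  have : Module.IsTorsionFree (integers p F) E := Module.IsTorsionFree.trans_faithfulSMul _ F _
  exact IsIntegralClosure.rank (integers p F) F E (integers p E)

lemma ramificationIndex_eq :
    ramificationIndex p F E = (maximalIdeal (integers p E)).ramificationIdx (integers p F) := by
  have := integers_isTorsionFree p F E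
  have := integers_liesOver p F E
  exact Ideal.ramificationIdx'_eq_ramificationIdx _ _ (IsDiscreteValuationRing.not_a_field _)

/-- The fundamental identity `∑ e f = n` has a single term, since the upper ring is local. -/
lemma ramificationIndex_mul_inertiaDeg :
    ramificationIndex p F E * (maximalIdeal (integers p E)).inertiaDeg (integers p F) =
      Module.finrank F E := by
  have := integers_isTorsionFree p F E
  have := integers_finite p F E
  have := integers_liesOver p F E
  have hne := IsDiscreteValuationRing.not_a_field (integers p F)
  have huniq : ∀ q : (maximalIdeal (integers p F)).primesOver (integers p E),
      q = ⟨maximalIdeal _, inferInstance, inferInstance⟩ := by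
    rintro ⟨q, hq, hq'⟩
    refine Subtype.ext ?_
    have : q.IsMaximal := Ideal.IsMaximal.of_liesOver_isMaximal q (maximalIdeal (integers p F))
    exact eq_maximalIdeal this
  let : Fintype ((maximalIdeal (integers p F)).primesOver (integers p E)) :=
    { elems := {⟨maximalIdeal _, inferInstance, inferInstance⟩}
      complete := fun q => by rw [huniq q]; simp }
  rw [ramificationIndex_eq, ← integers_finrank p F E,
    ← Ideal.sum_ramification_inertia_eq_finrank (maximalIdeal (integers p F)) (integers p E)]
  symm
  exact Fintype.sum_eq_single ⟨maximalIdeal _, inferInstance, inferInstance⟩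
    (fun q hq => absurd (huniq q) hq)
    (f := fun q => q.1.ramificationIdx (integers p F) * q.1.inertiaDeg (integers p F))

lemma card_residueField_pow : Nat.card (residueField p F) ^
      (maximalIdeal (integers p E)).inertiaDeg (integers p F) = Nat.card (residueField p E) := by
  have := integers_finite p F E
  have := integers_liesOver p F E
  exact Ideal.cardQuot_pow_inertiaDeg (maximalIdeal (integers p F)) (maximalIdeal (integers p E))

lemma integers_isGaloisGroup [IsGalois F E] :
    IsGaloisGroup Gal(E/F) (integers p F) (integers p E) := by
  have := integers_isScalarTower p F E
  have := integers_finite p F E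
  have := finiteDimensional_of_padic p F E
  have : IsFractionRing (integers p E) E := inferInstance
  have : SMulDistribClass Gal(E/F) (integers p E) E := ⟨fun g x y => by
    simp only [Algebra.smul_def]; exact map_mul g _ _⟩
  exact IsGaloisGroup.of_isFractionRing Gal(E/F) (integers p F) (integers p E) F E

end Extension

/-- A discrete valuation ring which is the closed unit ball of a complete normed field is
adically complete. -/
lemma isAdicComplete_of_norm_le_one {E : Type*} [NormedField E] [CompleteSpace E]
    (A : ValuationSubring E) [IsDiscreteValuationRing A] (hA : ∀ x, x ∈ A ↔ ‖x‖ ≤ 1) :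
    IsAdicComplete (maximalIdeal A) A where
  prec' f hf := by
    obtain ⟨ϖ, hϖ⟩ := IsDiscreteValuationRing.exists_irreducible A
    have hϖ0 : (ϖ : E) ≠ 0 := fun h => hϖ.ne_zero (Subtype.ext h)
    have hr0 : 0 < ‖(ϖ : E)‖ := norm_pos_iff.mpr hϖ0
    have hr1 : ‖(ϖ : E)‖ < 1 := by
      refine lt_of_le_of_ne ((hA _).mp ϖ.2) fun h => hϖ.not_isUnit ?_
      have h2 : (ϖ : E)⁻¹ ∈ A := by rw [hA, norm_inv, h, inv_one]
      exact IsUnit.of_mul_eq_one ⟨_, h2⟩ (Subtype.ext (mul_inv_cancel₀ hϖ0))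
    -- Powers of the maximal ideal are balls, so adic Cauchy sequences are Cauchy for the norm.
    have hmem (n : ℕ) (x : A) :
        x ∈ maximalIdeal A ^ n ↔ ‖(x : E)‖ ≤ ‖(ϖ : E)‖ ^ n := by
      rw [hϖ.maximalIdeal_eq, Ideal.span_singleton_pow, Ideal.mem_span_singleton]
      constructor
      · rintro ⟨y, rfl⟩
        push_cast
        rw [norm_mul, norm_pow]
        exact mul_le_of_le_one_right (by positivity) ((hA _).mp y.2)
      · intro h
        have h2 : (x : E) / (ϖ : E) ^ n ∈ A := by
          rw [hA, norm_div, norm_pow]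
          exact div_le_one_of_le₀ h (by positivity)
        exact ⟨⟨_, h2⟩, Subtype.ext (by push_cast; field_simp)⟩
    simp only [smul_eq_mul, Ideal.mul_top, SModEq.sub_mem] at hf ⊢
    have hf' {m n : ℕ} (h : m ≤ n) : ‖(f m : E) - f n‖ ≤ ‖(ϖ : E)‖ ^ m := (hmem m _).mp (hf h)
    have hc : CauchySeq fun n => (f n : E) := by
      refine cauchySeq_of_le_tendsto_0' (fun n => ‖(ϖ : E)‖ ^ n) (fun m n h => ?_)
        (tendsto_pow_atTop_nhds_zero_of_lt_one hr0.le hr1)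
      rw [dist_eq_norm]
      exact hf' h
    obtain ⟨x, hx⟩ := cauchySeq_tendsto_of_complete hc
    have hxn (n : ℕ) : ‖(f n : E) - x‖ ≤ ‖(ϖ : E)‖ ^ n :=
      le_of_tendsto ((tendsto_const_nhds.sub hx).norm)
        (Filter.eventually_atTop.mpr ⟨n, fun m hm => hf' hm⟩)
    have hx1 : x ∈ A := by
      have h0 : (f 0 : E) - x ∈ A := (hA _).mpr (by simpa using hxn 0)
      simpa using sub_mem (f 0).2 h0
    exact ⟨⟨x, hx1⟩, fun n => (hmem n _).mpr (hxn n)⟩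

/-! ### Completeness, finiteness of the residue field, valuation of `p`. -/

section Complete

variable (p : ℕ) [Fact p.Prime] (E : Type*) [Field E] [Algebra ℚ_[p] E] [FiniteDimensional ℚ_[p] E]

instance : IsAdicComplete (maximalIdeal (integers p E)) (integers p E) :=
  letI : NormedField E := spectralNorm.normedField ℚ_[p] E
  letI : CompleteSpace E := spectralNorm.completeSpace (K := ℚ_[p]) (L := E)
  isAdicComplete_of_norm_le_one (integers p E) (fun x => isPadicIntegral_iff p x)

instance : HenselianLocalRing (integers p E) where
  is_henselian f hf a h1 h2 :=
    HenselianRing.is_henselian (I := maximalIdeal (integers p E)) f hf a h1 (h2.map _)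

instance : Finite (residueField p E) := by
  refine Nat.finite_of_card_ne_zero ?_
  rw [← card_residueField_pow p ℚ_[p] E, card_residueField_padic]
  exact pow_ne_zero _ (Fact.out : p.Prime).ne_zero

lemma irreducible_padic : Irreducible (p : integers p ℚ_[p]) := by
  have h := (MulEquiv.irreducible_iff (padicIntEquivIntegers p)).mpr
    (PadicInt.irreducible_p (p := p))
  rwa [map_natCast] at h

/-- Turns the ideal-theoretic absolute ramification index into the valuation of `p`: the number `p`
generates the maximal ideal of the integers of `ℚ_[p]`. -/
lemma associated_natCast {ϖ : integers p E} (hϖ : Irreducible ϖ) :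
    Associated (p : integers p E) (ϖ ^ ramificationIndex p ℚ_[p] E) := by
  have hp : (p : integers p E) ≠ 0 := fun h => by
    have := charZero_of_padic p E
    exact (Fact.out : p.Prime).ne_zero (by exact_mod_cast congrArg Subtype.val h)
  obtain ⟨n, hn⟩ := IsDiscreteValuationRing.associated_pow_irreducible hp hϖ
  suffices ramificationIndex p ℚ_[p] E = n by rwa [this]
  let := integersAlgebra p ℚ_[p] E
  have hmap : (maximalIdeal (integers p ℚ_[p])).map (algebraMap _ (integers p E)) =
      Ideal.span {ϖ ^ n} := by
    rw [(irreducible_padic p).maximalIdeal_eq, Ideal.map_span, Set.image_singleton, map_natCast,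
      Ideal.span_singleton_eq_span_singleton]
    exact hn
  refine Ideal.ramificationIdx'_spec ?_ ?_
  · rw [hmap, hϖ.maximalIdeal_eq, Ideal.span_singleton_pow]
  · rw [hmap, hϖ.maximalIdeal_eq, Ideal.span_singleton_pow, Ideal.span_singleton_le_span_singleton,
      pow_dvd_pow_iff hϖ.ne_zero hϖ.not_isUnit]
    lia

end Complete

/-! ### Towers, and the order of the inertia group. -/

section Galois

variable (p : ℕ) [Fact p.Prime]
  (F : Type*) [Field F] [Algebra ℚ_[p] F] [FiniteDimensional ℚ_[p] F]
  (E : Type*) [Field E] [Algebra ℚ_[p] E] [FiniteDimensional ℚ_[p] E]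
  [Algebra F E] [IsScalarTower ℚ_[p] F E]

lemma ramificationIndex_tower :
    ramificationIndex p ℚ_[p] E = ramificationIndex p ℚ_[p] F * ramificationIndex p F E := by
  let := integersAlgebra p ℚ_[p] E
  let := integersAlgebra p ℚ_[p] F
  let := integersAlgebra p F E
  have : IsScalarTower (integers p ℚ_[p]) (integers p F) (integers p E) :=
    IsScalarTower.of_algebraMap_eq fun x =>
      Subtype.ext (IsScalarTower.algebraMap_apply ℚ_[p] F E x)
  have := integers_isTorsionFree p F E
  have := integers_isTorsionFree p ℚ_[p] F
  have := integers_liesOver p F E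
  have := integers_liesOver p ℚ_[p] F
  exact Ideal.ramificationIdx'_algebra_tower' _ _ _

lemma finrank_residueField_padic :
    ramificationIndex p ℚ_[p] E * Module.finrank (ZMod p) (residueField p E) =
      Module.finrank ℚ_[p] E := by
  have h1 := ramificationIndex_mul_inertiaDeg p ℚ_[p] E
  have h2 := card_residueField_pow p ℚ_[p] E
  rw [card_residueField_padic, Module.natCard_eq_pow_finrank (K := ZMod p), Nat.card_zmod] at h2
  rw [← h1, Nat.pow_right_injective (Fact.out : p.Prime).two_le h2]

omit [FiniteDimensional ℚ_[p] F] in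
lemma mem_inertiaSubgroup_iff (g : Gal(E/F)) :
    g ∈ inertiaSubgroup p F E ↔ ∀ x : residueField p E, g • x = x := by
  rw [MonoidHom.mem_ker]
  exact ⟨fun h x => congrArg (fun f : residueField p E ≃+* _ => f x) h, fun h => RingEquiv.ext h⟩

lemma card_inertiaSubgroup [IsGalois F E] :
    Nat.card (inertiaSubgroup p F E) = ramificationIndex p F E := by
  let := integersAlgebra p F E
  have := integers_isGaloisGroup p F E
  have := integers_isTorsionFree p F E
  have := integers_finite p F E
  have := integers_liesOver p F E
  have := finiteDimensional_of_padic p F E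
  have : Finite (maximalIdeal (integers p F)).ResidueField :=
    have : Finite (integers p F ⧸ maximalIdeal (integers p F)) :=
      inferInstanceAs (Finite (residueField p F))
    Finite.of_surjective _
      (Ideal.bijective_algebraMap_quotient_residueField (maximalIdeal (integers p F))).2
  have h := Ideal.card_inertia_eq_ramificationIdxIn (G := Gal(E/F))
    (maximalIdeal (integers p F)) (maximalIdeal (integers p E))
  rw [Ideal.ramificationIdxIn_eq_ramificationIdx (maximalIdeal (integers p F))
    (maximalIdeal (integers p E)) Gal(E/F), ← ramificationIndex_eq] at h
  rw [← h]
  -- It remains to compare two descriptions of inertia: acting trivially on the residue field, and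
  -- `g x - x` lying in the maximal ideal for all `x`.
  congr 2
  ext g
  rw [mem_inertiaSubgroup_iff, AddSubgroup.mem_inertia]
  rw [(residue_surjective (R := integers p E)).forall]
  refine forall_congr' fun x => ?_
  rw [← ResidueField.residue_smul, ← sub_eq_zero, ← map_sub, residue_eq_zero_iff]
  rfl

end Galois

/-! ### Modules over `𝔽_p[G]` and splitting of filtration steps. -/

section GroupAlgebra

variable {p : ℕ} [NeZero p] {G : Type*} [Group G]

/-- The group algebra `𝔽_p[G]` is additively generated by `G`. -/
theorem zmod_groupAlgebra_induction {motive : (ZMod p)[G] → Prop} (x : (ZMod p)[G])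
    (zero : motive 0) (of : ∀ g, motive (.of (ZMod p) G g))
    (add : ∀ x y, motive x → motive y → motive (x + y)) : motive x := by
  refine MonoidAlgebra.induction_on x of add fun r x hx => ?_
  rw [← ZMod.natCast_zmod_val r, Nat.cast_smul_eq_nsmul]
  induction r.val with
  | zero => simpa using zero
  | succ n ih => rw [succ_nsmul]; exact add _ _ ih hx

variable {M N : Type*} [AddCommGroup M] [Module (ZMod p)[G] M]
  [AddCommGroup N] [Module (ZMod p)[G] N]

/-- An additive map between `𝔽_p[G]`-modules which commutes with `G` is linear. -/
def linearMapOfEquivariant (f : M →+ N)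
    (hf : ∀ g x, f (MonoidAlgebra.of (ZMod p) G g • x) = MonoidAlgebra.of (ZMod p) G g • f x) :
    M →ₗ[(ZMod p)[G]] N where
  __ := f
  map_smul' r x := by
    simp only [ZeroHom.toFun_eq_coe, AddMonoidHom.toZeroHom_coe, RingHom.id_apply]
    induction r using zmod_groupAlgebra_induction with
    | zero => simp
    | of g => exact hf g x
    | add r s hr hs => rw [add_smul, map_add, hr, hs, add_smul]

/-- A bijective additive map commuting with `G` is an isomorphism of `𝔽_p[G]`-modules. -/
def linearEquivOfEquivariant (f : M →+ N)
    (hf : ∀ g x, f (MonoidAlgebra.of (ZMod p) G g • x) = MonoidAlgebra.of (ZMod p) G g • f x)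
    (hb : Function.Bijective f) : M ≃ₗ[(ZMod p)[G]] N :=
  LinearEquiv.ofBijective (linearMapOfEquivariant f hf) hb

/-- An additive subgroup stable under `G` is an `𝔽_p[G]`-submodule. -/
def submoduleOfStable (S : AddSubgroup M)
    (hS : ∀ g, ∀ x ∈ S, MonoidAlgebra.of (ZMod p) G g • x ∈ S) : Submodule (ZMod p)[G] M where
  __ := S
  smul_mem' r x hx := by
    induction r using zmod_groupAlgebra_induction with
    | zero => rw [zero_smul]; exact S.zero_mem
    | of g => exact hS g x hx
    | add r s hr hs => rw [add_smul]; exact S.add_mem hr hs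

variable {X : Type*} [Group X] [MulDistribMulAction G X]

/-- The image in an `𝔽_p[G]`-module of a `G`-stable subgroup. -/
def imageSubmodule (π : X →* Multiplicative M)
    (hπ : ∀ g x, (π (g • x)).toAdd = MonoidAlgebra.of (ZMod p) G g • (π x).toAdd)
    (H : Subgroup X) (hH : ∀ (g : G), ∀ x ∈ H, g • x ∈ H) : Submodule (ZMod p)[G] M :=
  submoduleOfStable (AddSubgroup.toSubgroup.symm (H.map π)) fun g => by
    rintro _ ⟨x, hx, rfl⟩
    exact ⟨g • x, hH g x hx, hπ g x⟩

/-- An equivariant homomorphism from a subgroup `H` of `X` whose kernel contains that of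
`π : X → M` descends to the image of `H`. -/
lemma exists_linearMap_of_image (π : X →* Multiplicative M)
    (hπ : ∀ g x, (π (g • x)).toAdd = MonoidAlgebra.of (ZMod p) G g • (π x).toAdd)
    (H : Subgroup X) (hH : ∀ (g : G), ∀ x ∈ H, g • x ∈ H) (S : Submodule (ZMod p)[G] M)
    (ψ : X → N) (hadd : ∀ x ∈ H, ∀ y ∈ H, ψ (x * y) = ψ x + ψ y)
    (hsmul : ∀ (g : G), ∀ x ∈ H, ψ (g • x) = MonoidAlgebra.of (ZMod p) G g • ψ x)
    (hker : ∀ x ∈ H, ψ x = 0 ↔ (π x).toAdd ∈ S) (hsurj : ∀ v, ∃ x ∈ H, ψ x = v) :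
    ∃ f : imageSubmodule π hπ H hH →ₗ[(ZMod p)[G]] N, Function.Surjective f ∧
      ∀ m, f m = 0 ↔ (m : M) ∈ S := by
  choose u hu hu' using fun m : imageSubmodule π hπ H hH => m.2
  have hone : ψ 1 = 0 := by simpa using hadd 1 H.one_mem 1 H.one_mem
  have hinv : ∀ x ∈ H, ψ x⁻¹ = - ψ x := fun x hx => by
    rw [eq_neg_iff_add_eq_zero, ← hadd _ (H.inv_mem hx) _ hx, inv_mul_cancel, hone]
  -- Independence of the chosen preimage: `x y⁻¹` is sent by `π` to `0 ∈ S`, hence is killed by `ψ`.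
  have hwell : ∀ x ∈ H, ∀ y ∈ H, π x = π y → ψ x = ψ y := fun x hx y hy h => by
    have h2 : ψ (x * y⁻¹) = 0 := by
      rw [hker _ (H.mul_mem hx (H.inv_mem hy)), map_mul, map_inv, h, mul_inv_cancel]
      exact S.zero_mem
    rwa [hadd _ hx _ (H.inv_mem hy), hinv _ hy, ← sub_eq_add_neg, sub_eq_zero] at h2
  have hu'' (m) : π (u m) = Multiplicative.ofAdd (m : M) := hu' m
  let f : imageSubmodule π hπ H hH →+ N := AddMonoidHom.mk' (fun m => ψ (u m)) fun a b => by
    rw [← hadd _ (hu a) _ (hu b)]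
    refine hwell _ (hu _) _ (H.mul_mem (hu a) (hu b)) ?_
    rw [map_mul, hu'', hu'', hu'']
    rfl
  refine ⟨linearMapOfEquivariant f fun g m => ?_, fun v => ?_, fun m => ?_⟩
  · change ψ _ = _ • ψ _
    rw [← hsmul _ _ (hu m)]
    refine hwell _ (hu _) _ (hH g _ (hu m)) ?_
    rw [hu'']
    exact congrArg Multiplicative.ofAdd (((hπ g (u m)).trans (by rw [hu'']; rfl)).symm)
  · obtain ⟨x, hx, rfl⟩ := hsurj v
    refine ⟨⟨(π x).toAdd, x, hx, rfl⟩, hwell _ (hu _) _ hx ?_⟩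
    rw [hu'']
    rfl
  · change ψ _ = 0 ↔ _
    rw [hker _ (hu m), hu'']
    rfl

/-- A filtration step with projective quotient splits. -/
lemma nonempty_linearEquiv_prod {R M N : Type*} [Ring R] [AddCommGroup M] [Module R M]
    [AddCommGroup N] [Module R N] [Module.Projective R N] (A S : Submodule R M) (hSA : S ≤ A)
    (f : A →ₗ[R] N) (hf : Function.Surjective f) (hker : ∀ m, f m = 0 ↔ (m : M) ∈ S) :
    Nonempty (A ≃ₗ[R] S × N) := by
  obtain ⟨s, hs⟩ := Module.projective_lifting_property f LinearMap.id hf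
  refine ⟨(lequivProdOfRightSplitExact (j := Submodule.inclusion hSA)
    (Submodule.inclusion_injective hSA) ?_ hs).symm⟩
  ext m
  rw [LinearMap.mem_ker, hker, Submodule.range_inclusion, Submodule.mem_comap]
  rfl

end GroupAlgebra

/-! ### The Artin–Schreier map on a finite field. -/

section ArtinSchreier

variable (p : ℕ) [Fact p.Prime] {k : Type*} [Field k] [Finite k] [Algebra (ZMod p) k]

/-- The Artin–Schreier map `x ↦ x ^ p - x`. -/
def artinSchreier : k →ₗ[ZMod p] k :=
  (FiniteField.frobeniusAlgHom (ZMod p) k).toLinearMap - LinearMap.id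

omit [Finite k] in
lemma artinSchreier_apply (x : k) : artinSchreier p x = x ^ p - x := by
  simp [artinSchreier]

lemma trace_pow_prime (x : k) : Algebra.trace (ZMod p) k (x ^ p) = Algebra.trace (ZMod p) k x := by
  have := Algebra.trace_eq_of_algEquiv (FiniteField.frobeniusAlgEquivOfAlgebraic (ZMod p) k) x
  simpa using this

/-- The additive form of Hilbert's theorem 90 for a finite field over its prime field. -/
lemma trace_eq_zero_iff (x : k) :
    Algebra.trace (ZMod p) k x = 0 ↔ ∃ y, y ^ p - y = x := by
  have hle : LinearMap.range (artinSchreier p (k := k)) ≤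
      LinearMap.ker (Algebra.trace (ZMod p) k) := by
    rintro _ ⟨y, rfl⟩
    rw [LinearMap.mem_ker, artinSchreier_apply, map_sub, trace_pow_prime, sub_self]
  -- The kernel of `y ^ p - y` is at most the prime field, so its image has codimension at most one;
  -- it lies in the kernel of the surjective trace, of codimension one, and thus equals it.
  have hker : Module.finrank (ZMod p) (LinearMap.ker (artinSchreier p (k := k))) ≤ 1 := by
    have hs : LinearMap.ker (artinSchreier p (k := k)) ≤ Submodule.span (ZMod p) {1} := by
      intro y hy
      rw [LinearMap.mem_ker, artinSchreier_apply, sub_eq_zero] at hy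
      have : CharP k p := charP_of_injective_algebraMap (algebraMap (ZMod p) k).injective p
      have h2 : y ∈ (⊥ : Subfield k) := (Subfield.mem_bot_iff_pow_eq_self k p).mpr hy
      rw [← ZMod.fieldRange_castHom_eq_bot p] at h2
      obtain ⟨a, rfl⟩ := h2
      rw [Submodule.mem_span_singleton]
      refine ⟨a, ?_⟩
      rw [Algebra.smul_def, mul_one]
      exact congrArg (fun f : ZMod p →+* k => f a) (Subsingleton.elim _ _)
    refine (Submodule.finrank_mono hs).trans ?_
    exact (finrank_span_le_card _).trans (by simp)
  have h1 := LinearMap.finrank_range_add_finrank_ker (artinSchreier p (k := k))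
  have h2 := LinearMap.finrank_range_add_finrank_ker (Algebra.trace (ZMod p) k)
  rw [LinearMap.range_eq_top.mpr (Algebra.trace_surjective (ZMod p) k), finrank_top,
    Module.finrank_self] at h2
  have heq := Submodule.eq_of_le_of_finrank_le hle (by lia)
  rw [← LinearMap.mem_ker, ← heq]
  simp [artinSchreier_apply]

end ArtinSchreier

/-! ### Raising principal units to the power `p`. -/

section Binomial

open Polynomial

/-- `S` collects the integers `(p.choose k) / p` for `0 < k < p`. Its constant term makes `S y` a
principal unit for small `y`; the degree bound keeps the polynomial used with Hensel's lemma monic.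
-/
lemma exists_one_add_pow_prime (p : ℕ) [hp : Fact p.Prime] (R : Type*) [CommRing R] :
    ∃ S : R[X], S.natDegree ≤ p - 2 ∧ S.eval 0 = 1 ∧
      ∀ y, (1 + y) ^ p = 1 + y ^ p + p * y * S.eval y := by
  refine ⟨∑ k ∈ Finset.Ioo 0 p, X ^ (k - 1) * C ((p.choose k / p : ℕ) : R), ?_, ?_, fun y => ?_⟩
  · refine natDegree_sum_le_of_forall_le _ _ fun k hk => ?_
    rw [Finset.mem_Ioo] at hk
    exact (natDegree_mul_C_le _ _).trans ((natDegree_X_pow_le _).trans (by lia))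
  · rw [eval_finsetSum, Finset.sum_eq_single 1]
    · simp [Nat.div_self hp.out.pos]
    · intro k hk hk1
      rw [Finset.mem_Ioo] at hk
      have : k - 1 ≠ 0 := by lia
      simp [this]
    · intro h
      exact absurd (Finset.mem_Ioo.mpr ⟨one_pos, hp.out.one_lt⟩) h
  · have := add_pow_prime_eq hp.out y 1
    rw [add_comm 1 y, this, eval_finsetSum]
    simp only [one_pow, mul_one, eval_mul, eval_pow, eval_X, eval_C]
    ring

end Binomial

section Powers

variable {p : ℕ} [hp : Fact p.Prime] {B : Type*} [CommRing B] [IsDomain B] [IsLocalRing B]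
  [CharP (ResidueField B) p]

omit hp [IsDomain B] in
lemma residue_natCast_prime : residue B (p : B) = 0 := by
  rw [map_natCast]; exact CharP.cast_eq_zero _ p

omit [IsDomain B] in
lemma residue_eq_one_of_pow (x : B) (h : residue B (x ^ p) = 1) : residue B x = 1 := by
  refine frobenius_inj (ResidueField B) p ?_
  rw [frobenius_def, frobenius_def, ← map_pow, h, one_pow]

omit [IsDomain B] in
lemma residue_eval_of_dvd {S : Polynomial B} (hS : S.eval 0 = 1) {ϖ y : B}
    (hϖ : residue B ϖ = 0) (hy : ϖ ∣ y) : residue B (S.eval y) = 1 := by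
  obtain ⟨c, hc⟩ := Polynomial.sub_dvd_eval_sub y 0 S
  obtain ⟨d, rfl⟩ := hy
  rw [sub_zero, hS, sub_eq_iff_eq_add] at hc
  rw [hc]
  simp [hϖ]

variable {ζ : B} (hζ : IsPrimitiveRoot ζ p)

include hζ

omit [IsDomain B] in
lemma residue_primitiveRoot : residue B ζ = 1 :=
  residue_eq_one_of_pow (p := p) ζ (by rw [hζ.pow_eq_one, map_one])

omit [IsDomain B] [IsLocalRing B] [CharP (ResidueField B) p] in
lemma primitiveRoot_sub_one_ne_zero : ζ - 1 ≠ 0 :=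
  sub_ne_zero.mpr (hζ.ne_one hp.out.one_lt)

/-- `p` is `-(ζ - 1) ^ (p - 1)` up to a principal unit. -/
lemma exists_natCast_eq_mul_pow :
    ∃ v : B, (p : B) = v * (ζ - 1) ^ (p - 1) ∧ residue B v = -1 := by
  obtain ⟨S, -, hS, hpow⟩ := exists_one_add_pow_prime p B
  have h0 : residue B (ζ - 1) = 0 := by rw [map_sub, residue_primitiveRoot hζ, map_one, sub_self]
  have h1 := residue_eval_of_dvd hS h0 dvd_rfl
  have hu : IsUnit (S.eval (ζ - 1)) := by
    rw [← not_not (a := IsUnit _), ← mem_nonunits_iff, ← mem_maximalIdeal, ← residue_eq_zero_iff,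
      h1]
    exact one_ne_zero
  obtain ⟨u, hu⟩ := hu
  have h2 := hpow (ζ - 1)
  rw [add_sub_cancel, hζ.pow_eq_one, ← Nat.sub_add_cancel hp.out.one_le, pow_succ,
    Nat.sub_add_cancel hp.out.one_le] at h2
  -- This is `(1 + (ζ - 1)) ^ p = 1` divided by `ζ - 1`.
  have h3 : (ζ - 1) ^ (p - 1) + p * S.eval (ζ - 1) = 0 := by
    refine mul_left_cancel₀ (primitiveRoot_sub_one_ne_zero hζ) ?_
    linear_combination -h2
  refine ⟨-↑u⁻¹, ?_, ?_⟩
  · rw [← hu] at h3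
    have := u.mul_inv
    linear_combination (-p : B) * this + (↑u⁻¹ : B) * h3
  · have := congrArg (residue B) u.mul_inv
    rw [map_mul, hu, h1, one_mul, map_one] at this
    rw [map_neg, this]

/-- If `x` is congruent to `1` modulo `ζ - 1`, then `x ^ p` is congruent to `1` modulo
`(ζ - 1) ^ p`. -/
lemma pow_dvd_pow_sub_one_of_dvd {x : B} (hx : ζ - 1 ∣ x - 1) : (ζ - 1) ^ p ∣ x ^ p - 1 := by
  obtain ⟨S, -, -, hpow⟩ := exists_one_add_pow_prime p B
  obtain ⟨v, hv, -⟩ := exists_natCast_eq_mul_pow hζ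
  obtain ⟨z, hz⟩ := hx
  have h := hpow (x - 1)
  rw [add_sub_cancel] at h
  refine ⟨z ^ p + v * z * S.eval (x - 1), ?_⟩
  have h2 : (ζ - 1) ^ p = (ζ - 1) ^ (p - 1) * (ζ - 1) := by
    rw [← pow_succ, Nat.sub_add_cancel hp.out.one_le]
  rw [h, hv, hz, h2]
  have h3 : ((ζ - 1) * z) ^ p = (ζ - 1) ^ (p - 1) * (ζ - 1) * z ^ p := by rw [mul_pow, h2]
  rw [h3]
  ring

/-- The class of `((1 + (ζ - 1) z) ^ p - 1) / (ζ - 1) ^ p`. -/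
lemma exists_pow_sub_one_eq (z : B) : ∃ c, (1 + (ζ - 1) * z) ^ p - 1 = (ζ - 1) ^ p * c ∧
    residue B c = residue B z ^ p - residue B z := by
  obtain ⟨S, -, hS, hpow⟩ := exists_one_add_pow_prime p B
  obtain ⟨v, hv, hv1⟩ := exists_natCast_eq_mul_pow hζ
  have h0 : residue B (ζ - 1) = 0 := by rw [map_sub, residue_primitiveRoot hζ, map_one, sub_self]
  have hS1 := residue_eval_of_dvd hS h0 (dvd_mul_right _ z)
  -- Both terms have the factor `(ζ - 1) ^ p`, because `p = v (ζ - 1) ^ (p - 1)`; as `v` reduces to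
  -- `-1`, the linear term contributes `-z`.
  refine ⟨z ^ p + v * z * S.eval ((ζ - 1) * z), ?_, ?_⟩
  · have h2 : (ζ - 1) ^ p = (ζ - 1) ^ (p - 1) * (ζ - 1) := by
      rw [← pow_succ, Nat.sub_add_cancel hp.out.one_le]
    rw [hpow, hv, mul_pow, h2]
    ring
  · rw [map_add, map_mul, map_mul, hS1, hv1, map_pow]
    ring

variable {ϖ : B} (hϖ : residue B ϖ = 0) {e : ℕ} (he : Associated (ζ - 1) (ϖ ^ e))

include hϖ he

/-- Below the level of `ζ - 1`, raising to the power `p` multiplies the level by `p`. -/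
lemma exists_pow_sub_one_eq_of_lt {j : ℕ} (hj : j < e) (u : B) :
    ∃ w, (1 + ϖ ^ j * u) ^ p - 1 = ϖ ^ (p * j) * w ∧ residue B w = residue B u ^ p := by
  obtain ⟨S, -, -, hpow⟩ := exists_one_add_pow_prime p B
  obtain ⟨v, hv, -⟩ := exists_natCast_eq_mul_pow hζ
  obtain ⟨η, hη⟩ := he.symm
  -- The valuation of `p ϖ ^ j` exceeds `p j` by `(p - 1) (e - j) > 0`. The form `+ 1 … - 1` lets
  -- one factor `ϖ` be split off, so that the linear term vanishes in the residue class of `w`.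
  have hexp : e * (p - 1) + j = p * j + 1 + (p - 1) * (e - j) - 1 := by
    obtain ⟨q, hq⟩ : ∃ q, p = q + 1 := ⟨p - 1, by have := hp.out.pos; lia⟩
    obtain ⟨d, rfl⟩ := Nat.exists_eq_add_of_lt hj
    subst hq
    have h1 : j + d + 1 - j = d + 1 := by lia
    rw [h1, Nat.add_sub_cancel]
    have : (j + d + 1) * q + j = (q + 1) * j + q * (d + 1) := by ring
    lia
  have hpos : 0 < (p - 1) * (e - j) :=
    Nat.mul_pos (by have := hp.out.two_le; lia) (by lia)
  refine ⟨u ^ p + ϖ * (ϖ ^ ((p - 1) * (e - j) - 1) * v * η ^ (p - 1) * u * S.eval (ϖ ^ j * u)),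
    ?_, by simp [hϖ]⟩
  have h4 : ϖ ^ (e * (p - 1)) * ϖ ^ j =
      ϖ ^ (p * j) * ϖ * ϖ ^ ((p - 1) * (e - j) - 1) := by
    rw [← pow_add, ← pow_succ, ← pow_add]
    congr 1
    lia
  rw [hpow, hv, ← hη, mul_pow, mul_pow, ← pow_mul, ← pow_mul, mul_comm j p]
  linear_combination (v * (η : B) ^ (p - 1) * u * S.eval (ϖ ^ j * u)) * h4

end Powers

/-! ### Levels of `p`-th powers, and Hensel's lemma. -/

section DVR

variable {p : ℕ} [hp : Fact p.Prime] {B : Type*} [CommRing B] [IsDomain B]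
  [IsDiscreteValuationRing B] [CharP (ResidueField B) p] {ζ : B} (hζ : IsPrimitiveRoot ζ p)
  {ϖ : B} (hϖ : Irreducible ϖ) {e : ℕ} (he : Associated (ζ - 1) (ϖ ^ e))

lemma residue_irreducible {B : Type*} [CommRing B] [IsLocalRing B] {ϖ : B} (hϖ : Irreducible ϖ) :
    residue B ϖ = 0 :=
  (residue_eq_zero_iff _).mpr ((mem_maximalIdeal _).mpr hϖ.not_isUnit)

lemma residue_eq_zero_iff_dvd {B : Type*} [CommRing B] [IsDomain B] [IsDiscreteValuationRing B]
    {ϖ : B} (hϖ : Irreducible ϖ) (x : B) : residue B x = 0 ↔ ϖ ∣ x := by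
  rw [residue_eq_zero_iff, hϖ.maximalIdeal_eq, Ideal.mem_span_singleton]

include hζ hϖ he

/-- A `p`-th power congruent to `1` modulo `ϖ` is either of level `p j` exactly, with `0 < j < e`,
or the `p`-th power of an element congruent to `1` modulo `ζ - 1`. -/
lemma pow_sub_one_cases {x : B} (hx : ϖ ∣ x ^ p - 1) :
    (∃ j w, 0 < j ∧ j < e ∧ x ^ p - 1 = ϖ ^ (p * j) * w ∧ residue B w ≠ 0) ∨ ζ - 1 ∣ x - 1 := by
  by_cases hx1 : x - 1 = 0
  · right; rw [hx1]; exact dvd_zero _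
  have h1 : residue B (x - 1) = 0 := by
    rw [map_sub, residue_eq_one_of_pow (p := p) x, map_one, sub_self]
    rw [← residue_eq_zero_iff_dvd hϖ, map_sub, map_one, sub_eq_zero] at hx
    exact hx
  obtain ⟨j, u, hju⟩ := IsDiscreteValuationRing.eq_unit_mul_pow_irreducible hx1 hϖ
  have hj0 : 0 < j := by
    rw [pos_iff_ne_zero]
    rintro rfl
    rw [hju, pow_zero, mul_one] at h1
    exact (residue_ne_zero_iff_isUnit _).mpr u.isUnit h1
  rcases lt_or_ge j e with hj | hj
  · left
    obtain ⟨w, hw, hw'⟩ := exists_pow_sub_one_eq_of_lt hζ (residue_irreducible hϖ) he hj (u : B)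
    refine ⟨j, w, hj0, hj, ?_, ?_⟩
    · rw [← hw, mul_comm _ (u : B), ← hju, add_sub_cancel]
    · rw [hw']
      exact pow_ne_zero _ ((residue_ne_zero_iff_isUnit _).mpr u.isUnit)
  · right
    rw [hju]
    exact (he.dvd.trans (pow_dvd_pow _ hj)).mul_left _

/-- By the dichotomy above, the level of `x ^ p - 1` is either a multiple of `p` or at least `p e`;
it is never exactly `i`. Dividing by `p`-th powers thus leaves the pieces of level prime to `p`
unchanged. -/
lemma pow_succ_dvd_pow_sub_one {x : B} {i : ℕ} (hi0 : 0 < i) (hi : i < p * e) (hpi : ¬ p ∣ i)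
    (hx : ϖ ^ i ∣ x ^ p - 1) : ϖ ^ (i + 1) ∣ x ^ p - 1 := by
  rcases pow_sub_one_cases hζ hϖ he ((dvd_pow_self _ hi0.ne').trans hx) with
    ⟨j, w, -, -, hw, hw'⟩ | h
  · rw [hw] at hx ⊢
    have hle : i ≤ p * j := by
      by_contra! hlt
      obtain ⟨d, hd⟩ := Nat.exists_eq_add_of_lt hlt
      rw [hd, add_assoc, pow_add, mul_dvd_mul_iff_left (pow_ne_zero _ hϖ.ne_zero), pow_succ] at hx
      exact hw' ((residue_eq_zero_iff_dvd hϖ _).mpr ((dvd_mul_left _ _).trans hx))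
    have hne : i ≠ p * j := fun h => hpi ⟨j, h⟩
    exact (pow_dvd_pow _ (by lia)).mul_right _
  · have h2 := pow_dvd_pow_sub_one_of_dvd hζ h
    refine dvd_trans ?_ h2
    refine dvd_trans (pow_dvd_pow _ (show i + 1 ≤ p * e from hi)) ?_
    rw [mul_comm, pow_mul]
    exact pow_dvd_pow_of_dvd he.symm.dvd _

/-- A `p`-th power congruent to `1` modulo `(ζ - 1) ^ p` is the `p`-th power of an element
congruent to `1` modulo `ζ - 1`. -/
lemma dvd_sub_one_of_pow_dvd (he0 : 0 < e) {x : B} (hx : (ζ - 1) ^ p ∣ x ^ p - 1) :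
    ζ - 1 ∣ x - 1 := by
  have h1 : ϖ ^ (p * e) ∣ x ^ p - 1 := by
    refine dvd_trans ?_ hx
    rw [mul_comm, pow_mul]
    exact pow_dvd_pow_of_dvd he.symm.dvd _
  rcases pow_sub_one_cases hζ hϖ he ((dvd_pow_self _ (Nat.mul_pos hp.out.pos he0).ne').trans h1)
    with ⟨j, w, -, hj, hw, hw'⟩ | h
  · exfalso
    rw [hw] at h1
    have hlt : p * j < p * e := Nat.mul_lt_mul_of_pos_left hj hp.out.pos
    obtain ⟨d, hd⟩ := Nat.exists_eq_add_of_lt hlt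
    rw [hd, add_assoc, pow_add, mul_dvd_mul_iff_left (pow_ne_zero _ hϖ.ne_zero), pow_succ] at h1
    exact hw' ((residue_eq_zero_iff_dvd hϖ _).mpr ((dvd_mul_left _ _).trans h1))
  · exact h

omit hϖ he in
/-- Hensel's lemma for `p`-th powers: `1 + (ζ - 1) ^ p c` is the `p`-th power of an element
congruent to `1` modulo `ζ - 1` if the class of `c` is in the image of the Artin–Schreier map. -/
lemma exists_pow_eq_of_residue [HenselianLocalRing B] {c : B}
    (hc : ∃ y, y ^ p - y = residue B c) : ∃ x : B, x ^ p = 1 + (ζ - 1) ^ p * c := by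
  obtain ⟨S, hSd, hS, hpow⟩ := exists_one_add_pow_prime p B
  obtain ⟨v, hv, hv1⟩ := exists_natCast_eq_mul_pow hζ
  obtain ⟨y, hy⟩ := hc
  obtain ⟨a, rfl⟩ := residue_surjective y
  have h0 : residue B (ζ - 1) = 0 := by rw [map_sub, residue_primitiveRoot hζ, map_one, sub_self]
  let T : Polynomial B := S.comp (Polynomial.C (ζ - 1) * Polynomial.X)
  have hT (z : B) : T.eval z = S.eval ((ζ - 1) * z) := by simp [T]
  have hT1 (z : B) : residue B (T.eval z) = 1 := by
    rw [hT]; exact residue_eval_of_dvd hS h0 (dvd_mul_right _ z)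
  have hTder (z : B) : residue B (T.derivative.eval z) = 0 := by
    simp [T, Polynomial.derivative_comp, h0]
  have hTd : T.natDegree ≤ p - 2 := by
    refine Polynomial.natDegree_comp_le.trans ?_
    refine (Nat.mul_le_mul hSd (((Polynomial.natDegree_C_mul_le _ _).trans
      Polynomial.natDegree_X_le))).trans (by lia)
  -- The equation `(1 + (ζ - 1) X) ^ p = 1 + (ζ - 1) ^ p c`, divided by `(ζ - 1) ^ p`. Modulo the
  -- maximal ideal it becomes `X ^ p - X = c`, with derivative `-1`, so every residual root is
  -- simple.
  let F : Polynomial B := Polynomial.X ^ p +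
    (Polynomial.C v * Polynomial.X * T - Polynomial.C c)
  have hF : F.Monic := by
    refine Polynomial.monic_X_pow_add ?_
    refine lt_of_le_of_lt Polynomial.degree_le_natDegree ?_
    have h2 := hp.out.two_le
    have : (Polynomial.C v * Polynomial.X * T - Polynomial.C c).natDegree ≤ p - 1 := by
      refine Polynomial.natDegree_sub_C.le.trans ?_
      refine Polynomial.natDegree_mul_le.trans ?_
      have := (Polynomial.natDegree_C_mul_le v Polynomial.X).trans Polynomial.natDegree_X_le
      lia
    exact_mod_cast (show _ < p by lia)
  have hFe (z : B) : F.eval z = z ^ p + (v * z * S.eval ((ζ - 1) * z) - c) := by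
    simp [F, hT]
  have hFd : residue B (F.derivative.eval a) = -1 := by
    have h : F.derivative.eval a =
        p * a ^ (p - 1) + (v * T.eval a + v * a * T.derivative.eval a) := by
      simp [F, Polynomial.derivative_mul, Polynomial.derivative_X_pow]
    rw [h]
    simp only [map_add, map_mul, hT1, hTder, hv1, residue_natCast_prime]
    ring
  obtain ⟨z, hz, -⟩ := HenselianLocalRing.is_henselian F hF a
    (by
      rw [← residue_eq_zero_iff, hFe, ← hT, map_add, map_sub, map_mul, map_mul, hT1, hv1, map_pow,
        ← hy]
      ring)
    (by
      rw [← residue_ne_zero_iff_isUnit, hFd]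
      exact neg_ne_zero.mpr one_ne_zero)
  refine ⟨1 + (ζ - 1) * z, ?_⟩
  have hz' : z ^ p + (v * z * S.eval ((ζ - 1) * z) - c) = 0 := by rw [← hFe]; exact hz
  have h2 : (ζ - 1) ^ p = (ζ - 1) ^ (p - 1) * (ζ - 1) := by
    rw [← pow_succ, Nat.sub_add_cancel hp.out.one_le]
  rw [hpow, hv, mul_pow, h2]
  linear_combination ((ζ - 1) ^ (p - 1) * (ζ - 1)) * hz'

end DVR

section Quotients

variable {B : Type*} [CommRing B] [IsDomain B]

open Classical in
/-- The quotient `x / d` if `d` divides `x`. -/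
def divCoeff (d x : B) : B := if h : d ∣ x then h.choose else 0

lemma divCoeff_eq {d x c : B} (hd : d ≠ 0) (h : x = d * c) : divCoeff d x = c := by
  have hdvd : d ∣ x := ⟨c, h⟩
  rw [divCoeff, dif_pos hdvd]
  exact mul_left_cancel₀ hd (hdvd.choose_spec.symm.trans h)

end Quotients

/-! ### The graded pieces as representations, and the unit filtration. -/

section Graded

variable (p : ℕ) {B : Type*} [CommRing B] [IsDomain B]
  [IsLocalRing B] [Algebra (ZMod p) (ResidueField B)]
  {G : Type*} [Group G] [MulSemiringAction G B]
  {ϖ : B} (hϖ : ϖ ≠ 0) {χ : G → B} (hχ : ∀ g, g • ϖ = χ g * ϖ)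

include hϖ hχ in
omit [IsLocalRing B] in
lemma cocycle_mul (g h : G) : χ (g * h) = χ g * g • χ h := by
  refine mul_right_cancel₀ hϖ ?_
  rw [← hχ, mul_smul, hχ h, smul_mul', hχ g]
  ring

include hϖ hχ in
omit [IsLocalRing B] in
lemma cocycle_one : χ 1 = 1 := by
  refine mul_right_cancel₀ hϖ ?_
  rw [← hχ, one_smul, one_mul]

/-- The representation of `G` on the residue field which describes its action on
`ϖ ^ i B / ϖ ^ (i + 1) B`. -/
def gradedRep (i : ℕ) : Representation (ZMod p) G (ResidueField B) where
  toFun g := ((AddMonoidHom.mulLeft (residue B (χ g) ^ i)).comp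
    (DistribSMul.toAddMonoidHom (ResidueField B) g)).toZModLinearMap p
  map_one' := by
    ext x
    simp [cocycle_one hϖ hχ]
  map_mul' g h := by
    ext x
    simp [cocycle_mul hϖ hχ, mul_smul, smul_mul', mul_pow, mul_assoc, ResidueField.residue_smul]

lemma gradedRep_apply (i : ℕ) (g : G) (x : ResidueField B) :
    gradedRep p hϖ hχ i g x = residue B (χ g) ^ i * g • x := rfl

/-- The `𝔽_p[G]`-module `ϖ ^ i B / ϖ ^ (i + 1) B`. -/
abbrev gradedModule (i : ℕ) : Type _ := (gradedRep p hϖ hχ i).asModule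

end Graded

lemma trace_smul {p : ℕ} [Fact p.Prime] {B : Type*} [CommRing B] [IsLocalRing B]
    [Algebra (ZMod p) (ResidueField B)] {G : Type*} [Group G] [MulSemiringAction G B]
    (g : G) (x : ResidueField B) :
    Algebra.trace (ZMod p) (ResidueField B) (g • x) =
      Algebra.trace (ZMod p) (ResidueField B) x :=
  Algebra.trace_eq_of_algEquiv (AlgEquiv.ofRingEquiv
    (f := MulSemiringAction.toRingEquiv G (ResidueField B) g) fun a =>
      congrArg (fun f : ZMod p →+* ResidueField B => f a) (Subsingleton.elim
        ((MulSemiringAction.toRingHom G (ResidueField B) g).comp (algebraMap _ _)) _)) x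

attribute [local instance] Units.mulDistribMulActionRight

section Filtration

variable {B : Type*} [CommRing B] {G : Type*} [Group G] [MulSemiringAction G B]

/-- The units congruent to `1` modulo `ϖ ^ i`. -/
def unitFiltration (ϖ : B) (i : ℕ) : Subgroup Bˣ where
  carrier := {u | ϖ ^ i ∣ (u : B) - 1}
  mul_mem' {u v} hu hv := by
    have : ((u * v : Bˣ) : B) - 1 = u * (v - 1) + (u - 1) := by push_cast; ring
    change ϖ ^ i ∣ _
    rw [this]
    exact dvd_add (hv.mul_left _) hu
  one_mem' := by simp
  inv_mem' {u} hu := by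
    have : ((u⁻¹ : Bˣ) : B) - 1 = -((u⁻¹ : Bˣ) : B) * (u - 1) := by
      have := u.inv_mul
      linear_combination this
    change ϖ ^ i ∣ _
    rw [this]
    exact hu.mul_left _

lemma mem_unitFiltration {ϖ : B} {i : ℕ} {u : Bˣ} :
    u ∈ unitFiltration ϖ i ↔ ϖ ^ i ∣ (u : B) - 1 := Iff.rfl

lemma unitFiltration_antitone (ϖ : B) : Antitone (unitFiltration ϖ) :=
  fun _ _ h _ hu => (pow_dvd_pow ϖ h).trans hu

lemma smul_mem_unitFiltration {ϖ : B} {χ : G → B} (hχ : ∀ g, g • ϖ = χ g * ϖ) (i : ℕ) (g : G) :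
    ∀ u ∈ unitFiltration ϖ i, g • u ∈ unitFiltration ϖ i := by
  rintro u ⟨c, hc⟩
  refine ⟨χ g ^ i * g • c, ?_⟩
  have : ((g • u : Bˣ) : B) - 1 = g • ((u : B) - 1) := by rw [smul_sub, smul_one]; rfl
  rw [this, hc, smul_mul', smul_pow', hχ, mul_pow]
  ring

end Filtration

/-! ### The individual steps of the filtration modulo `p`-th powers. -/

section Steps

variable {p : ℕ} [hp : Fact p.Prime] {B : Type*} [CommRing B] [IsDomain B]
  [IsDiscreteValuationRing B] [CharP (ResidueField B) p] [Algebra (ZMod p) (ResidueField B)]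
  {G : Type*} [Group G] [MulSemiringAction G B]
  {ζ : B} (hζ : IsPrimitiveRoot ζ p) {ϖ : B} (hϖ : Irreducible ϖ)
  {χ : G → B} (hχ : ∀ g, g • ϖ = χ g * ϖ) {e : ℕ} (he : Associated (ζ - 1) (ϖ ^ e))
  {M : Type*} [AddCommGroup M] [Module (ZMod p)[G] M] (π : Bˣ →* Multiplicative M)
  (hπ : ∀ g u, (π (g • u)).toAdd = MonoidAlgebra.of (ZMod p) G g • (π u).toAdd)
  (hker : ∀ u, π u = 1 ↔ ∃ x : Bˣ, x ^ p = u)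

/-- The image of the unit filtration in a module. -/
abbrev imageFiltration (i : ℕ) : Submodule (ZMod p)[G] M :=
  imageSubmodule π hπ (unitFiltration ϖ i) (smul_mem_unitFiltration hχ i)

omit [IsDomain B] [IsDiscreteValuationRing B] [CharP (ResidueField B) p] [Algebra (ZMod p) (ResidueField B)] in
lemma imageFiltration_antitone : Antitone (imageFiltration hχ π hπ) := by
  rintro i j h _ ⟨u, hu, hu'⟩
  exact ⟨u, unitFiltration_antitone ϖ h hu, hu'⟩

include hζ hϖ he hker

omit [Algebra (ZMod p) (ResidueField B)] in
-- Two units with the same image differ by a `p`-th power; if that power has level `i`, it has level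
-- `i + 1` by `pow_succ_dvd_pow_sub_one`.
lemma mem_imageFiltration_succ_iff {i : ℕ} (hi0 : 0 < i) (hi : i < p * e) (hpi : ¬ p ∣ i) {u : Bˣ}
    (hu : u ∈ unitFiltration ϖ i) :
    (π u).toAdd ∈ imageFiltration hχ π hπ (i + 1) ↔ u ∈ unitFiltration ϖ (i + 1) := by
  constructor
  · rintro ⟨u', hu', h⟩
    have h : π u' = π u := h
    obtain ⟨x, hx⟩ := (hker (u * u'⁻¹)).mp (by rw [map_mul, map_inv, h, mul_inv_cancel])
    have h1 : u * u'⁻¹ ∈ unitFiltration ϖ i :=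
      Subgroup.mul_mem _ hu (Subgroup.inv_mem _ (unitFiltration_antitone ϖ i.le_succ hu'))
    rw [← hx, mem_unitFiltration, Units.val_pow_eq_pow_val] at h1
    have h2 := pow_succ_dvd_pow_sub_one hζ hϖ he hi0 hi hpi h1
    rw [← Units.val_pow_eq_pow_val, ← mem_unitFiltration, hx] at h2
    simpa using Subgroup.mul_mem _ h2 hu'
  · exact fun h => ⟨u, h, rfl⟩

/-- The graded piece of level prime to `p`. -/
lemma nonempty_imageFiltration_equiv_prod {i : ℕ} (hi0 : 0 < i) (hi : i < p * e) (hpi : ¬ p ∣ i)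
    [Module.Projective (ZMod p)[G] (gradedModule p hϖ.ne_zero hχ i)] :
    Nonempty (imageFiltration hχ π hπ i ≃ₗ[(ZMod p)[G]]
      imageFiltration hχ π hπ (i + 1) × gradedModule p hϖ.ne_zero hχ i) := by
  have hd : ϖ ^ i ≠ 0 := pow_ne_zero _ hϖ.ne_zero
  -- The leading coefficient `1 + ϖ ^ i a ↦ a mod ϖ`.
  let ψ : Bˣ → gradedModule p hϖ.ne_zero hχ i :=
    fun u => (gradedRep p hϖ.ne_zero hχ i).asModuleEquiv.symm
      (residue B (divCoeff (ϖ ^ i) ((u : B) - 1)))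
  have hψ {u : Bˣ} {c : B} (h : (u : B) - 1 = ϖ ^ i * c) :
      ψ u = (gradedRep p hϖ.ne_zero hχ i).asModuleEquiv.symm (residue B c) := by
    simp only [ψ, divCoeff_eq hd h]
  suffices h : ∃ f : imageFiltration hχ π hπ i →ₗ[(ZMod p)[G]] gradedModule p hϖ.ne_zero hχ i,
      Function.Surjective f ∧ ∀ m, f m = 0 ↔ (m : M) ∈ imageFiltration hχ π hπ (i + 1) by
    obtain ⟨f, hf, hf'⟩ := h
    exact nonempty_linearEquiv_prod _ _ (imageFiltration_antitone hχ π hπ i.le_succ) f hf hf'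
  refine exists_linearMap_of_image π hπ (unitFiltration ϖ i)
    (smul_mem_unitFiltration hχ i) (imageFiltration hχ π hπ (i + 1)) ψ ?_ ?_ ?_ ?_
  · rintro u ⟨a, ha⟩ v ⟨b, hb⟩
    rw [hψ ha, hψ hb, hψ (c := a + b + ϖ ^ i * a * b), ← map_add]
    · congr 1
      simp [residue_irreducible hϖ, hi0.ne']
    · push_cast
      linear_combination (1 + ϖ ^ i * b) * ha + (u : B) * hb
  · rintro g u ⟨a, ha⟩
    rw [hψ ha, hψ (c := χ g ^ i * g • a), ← Representation.asModuleEquiv_symm_map_rho,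
      gradedRep_apply, map_mul, map_pow, ResidueField.residue_smul]
    have : ((g • u : Bˣ) : B) - 1 = g • ((u : B) - 1) := by rw [smul_sub, smul_one]; rfl
    rw [this, ha, smul_mul', smul_pow', hχ, mul_pow]
    ring
  · intro u hu
    rw [mem_imageFiltration_succ_iff hζ hϖ hχ he π hπ hker hi0 hi hpi hu]
    obtain ⟨a, ha⟩ := hu
    rw [hψ ha, LinearEquiv.map_eq_zero_iff, residue_eq_zero_iff_dvd hϖ, mem_unitFiltration, ha,
      pow_succ, mul_dvd_mul_iff_left hd]
  · intro v
    obtain ⟨a, ha⟩ := residue_surjective ((gradedRep p hϖ.ne_zero hχ i).asModuleEquiv v)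
    have hu : IsUnit (1 + ϖ ^ i * a) := by
      rw [← residue_ne_zero_iff_isUnit]
      simp [residue_irreducible hϖ, hi0.ne']
    obtain ⟨u, hu⟩ := hu
    have hu' : (u : B) - 1 = ϖ ^ i * a := by rw [hu]; ring
    exact ⟨u, ⟨a, hu'⟩, by rw [hψ hu', ha, LinearEquiv.symm_apply_apply]⟩

omit [Algebra (ZMod p) (ResidueField B)] in
/-- The graded piece of level divisible by `p`. -/
lemma imageFiltration_mul_eq [Finite (ResidueField B)] {j : ℕ} (hj0 : 0 < j) (hj : j < e) :
    imageFiltration hχ π hπ (p * j) = imageFiltration hχ π hπ (p * j + 1) := by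
  refine le_antisymm ?_ (imageFiltration_antitone hχ π hπ (Nat.le_succ _))
  rintro _ ⟨u, ⟨c, hc⟩, rfl⟩
  -- The residue field is perfect, so the leading coefficient is a `p`-th power `d ^ p`. Dividing
  -- `u` by `(1 + ϖ ^ j d) ^ p` raises its level without changing its image.
  obtain ⟨y, hy⟩ := (PerfectRing.bijective_frobenius (R := ResidueField B) (p := p)).2 (residue B c)
  obtain ⟨d, rfl⟩ := residue_surjective y
  obtain ⟨w, hw, hw'⟩ := exists_pow_sub_one_eq_of_lt hζ (residue_irreducible hϖ) he hj d
  have hu : IsUnit (1 + ϖ ^ j * d) := by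
    rw [← residue_ne_zero_iff_isUnit]
    simp [residue_irreducible hϖ, hj0.ne']
  obtain ⟨x, hx⟩ := hu
  refine ⟨u * (x ^ p)⁻¹, ?_, ?_⟩
  · have h1 : ϖ ^ (p * j + 1) ∣ (u : B) - (x ^ p : Bˣ) := by
      have h2 : ϖ ∣ c - w := by
        rw [← residue_eq_zero_iff_dvd hϖ, map_sub, hw', ← hy]
        exact sub_self _
      have h3 : (u : B) - (x ^ p : Bˣ) = ϖ ^ (p * j) * (c - w) := by
        rw [Units.val_pow_eq_pow_val, hx]
        linear_combination hc - hw
      rw [h3, pow_succ]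
      exact mul_dvd_mul_left _ h2
    have h4 : ((u * (x ^ p)⁻¹ : Bˣ) : B) - 1 =
        ((u : B) - (x ^ p : Bˣ)) * ((x ^ p)⁻¹ : Bˣ) := by
      rw [sub_mul, Units.mul_inv, Units.val_mul]
    change ϖ ^ (p * j + 1) ∣ _
    rw [h4]
    exact h1.mul_right _
  · change π _ = π u
    rw [map_mul, map_inv, (hker _).mpr ⟨x, rfl⟩, inv_one, mul_one]

/-- The last step of the filtration is isomorphic to the group of `p`-th roots of unity. -/
lemma nonempty_imageFiltration_equiv [HenselianLocalRing B] [Finite (ResidueField B)]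
    (he0 : 0 < e) {N : Type*} [AddCommGroup N] [Module (ZMod p)[G] N] (τ : ZMod p →+ N)
    (hτ : Function.Bijective τ) (hτG : ∀ (g : G) (n : ℕ), g • ζ = ζ ^ n →
      ∀ a, MonoidAlgebra.of (ZMod p) G g • τ a = τ (n * a)) :
    Nonempty (imageFiltration hχ π hπ (p * e) ≃ₗ[(ZMod p)[G]] N) := by
  have hd : (ζ - 1) ^ p ≠ 0 := pow_ne_zero _ (primitiveRoot_sub_one_ne_zero hζ)
  have hζ0 : residue B (ζ - 1) = 0 := by
    rw [map_sub, residue_primitiveRoot hζ, map_one, sub_self]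
  have hass : Associated ((ζ - 1) ^ p) (ϖ ^ (p * e)) := by
    rw [mul_comm, pow_mul]; exact he.pow_pow
  have hmem (u : Bˣ) : u ∈ unitFiltration ϖ (p * e) ↔ (ζ - 1) ^ p ∣ (u : B) - 1 :=
    hass.symm.dvd_iff_dvd_left
  let tr := Algebra.trace (ZMod p) (ResidueField B)
  -- The coefficient is taken relative to `(ζ - 1) ^ p` rather than `ϖ ^ (p e)`: in this
  -- normalization the `p`-th powers are exactly the units whose coefficient is an Artin–Schreier
  -- value, that is, has trace zero.
  let ψ : Bˣ → N := fun u => τ (tr (residue B (divCoeff ((ζ - 1) ^ p) ((u : B) - 1))))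
  have hψ {u : Bˣ} {c : B} (h : (u : B) - 1 = (ζ - 1) ^ p * c) : ψ u = τ (tr (residue B c)) := by
    simp only [ψ, divCoeff_eq hd h]
  suffices h : ∃ f : imageFiltration hχ π hπ (p * e) →ₗ[(ZMod p)[G]] N,
      Function.Surjective f ∧ ∀ m, f m = 0 ↔ (m : M) ∈ (⊥ : Submodule (ZMod p)[G] M) by
    obtain ⟨f, hf, hf'⟩ := h
    refine ⟨LinearEquiv.ofBijective f ⟨(injective_iff_map_eq_zero f).mpr fun m hm => ?_, hf⟩⟩
    exact Subtype.ext ((hf' m).mp hm)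
  refine exists_linearMap_of_image π hπ (unitFiltration ϖ (p * e))
    (smul_mem_unitFiltration hχ _) ⊥ ψ ?_ ?_ ?_ ?_
  · intro u hu v hv
    obtain ⟨a, ha⟩ := (hmem u).mp hu
    obtain ⟨b, hb⟩ := (hmem v).mp hv
    rw [hψ ha, hψ hb, hψ (c := a + b + (ζ - 1) ^ p * a * b), ← map_add, ← map_add]
    · congr 2
      rw [map_add, map_mul, map_mul, map_pow, hζ0, zero_pow hp.out.ne_zero, zero_mul, zero_mul,
        add_zero, map_add]
    · push_cast
      linear_combination (1 + (ζ - 1) ^ p * b) * ha + (u : B) * hb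
  · intro g u hu
    obtain ⟨a, ha⟩ := (hmem u).mp hu
    obtain ⟨n, -, hn⟩ := hζ.eq_pow_of_pow_eq_one (ξ := g • ζ)
      (by rw [← smul_pow', hζ.pow_eq_one, smul_one])
    -- If `g ζ = ζ ^ n`, then `g` multiplies `ζ - 1` by the geometric sum, congruent to `n`; since
    -- `n ^ p = n` in `𝔽_p`, it multiplies `(ζ - 1) ^ p` by `n` to leading order. This gives the
    -- twist by the action on `ζ`.
    have hs := geom_sum_mul ζ n
    have hsr : residue B (∑ i ∈ Finset.range n, ζ ^ i) = n := by
      simp [residue_primitiveRoot hζ]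
    rw [hψ ha, hψ (c := (∑ i ∈ Finset.range n, ζ ^ i) ^ p * g • a), hτG g n hn.symm]
    · congr 1
      have h1 : residue B ((∑ i ∈ Finset.range n, ζ ^ i) ^ p * g • a) =
          (n : ZMod p) • g • residue B a := by
        rw [map_mul, map_pow, hsr, ResidueField.residue_smul, Algebra.smul_def,
          map_natCast]
        congr 1
        have := congrArg (algebraMap (ZMod p) (ResidueField B)) (ZMod.pow_card (n : ZMod p))
        rwa [map_pow, map_natCast] at this
      rw [h1, map_smul, trace_smul, smul_eq_mul]
    · have : ((g • u : Bˣ) : B) - 1 = g • ((u : B) - 1) := by rw [smul_sub, smul_one]; rfl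
      rw [this, ha, smul_mul', smul_pow', smul_sub, smul_one, ← hn, ← hs, mul_pow]
      ring
  · intro u hu
    obtain ⟨a, ha⟩ := (hmem u).mp hu
    rw [hψ ha, map_eq_zero_iff τ hτ.1, trace_eq_zero_iff, Submodule.mem_bot, toAdd_eq_zero, hker]
    constructor
    · intro h
      obtain ⟨x, hx⟩ := exists_pow_eq_of_residue hζ h
      have hxu : x ^ p = u := by rw [hx]; linear_combination -ha
      have : IsUnit x := (isUnit_pow_iff hp.out.ne_zero).mp (hxu ▸ u.isUnit)
      obtain ⟨x, rfl⟩ := this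
      exact ⟨x, Units.ext (by rw [Units.val_pow_eq_pow_val, hxu])⟩
    · rintro ⟨x, rfl⟩
      rw [Units.val_pow_eq_pow_val] at ha
      obtain ⟨z, hz⟩ := dvd_sub_one_of_pow_dvd hζ hϖ he he0 ⟨a, ha⟩
      obtain ⟨c, hc, hc'⟩ := exists_pow_sub_one_eq hζ z
      rw [← hz, add_sub_cancel, ha] at hc
      exact ⟨residue B z, by rw [← hc', mul_left_cancel₀ hd hc]⟩
  · intro v
    obtain ⟨a, rfl⟩ := hτ.2 v
    obtain ⟨y, rfl⟩ := Algebra.trace_surjective (ZMod p) (ResidueField B) a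
    obtain ⟨c, rfl⟩ := residue_surjective y
    have hu : IsUnit (1 + (ζ - 1) ^ p * c) := by
      rw [← residue_ne_zero_iff_isUnit, map_add, map_mul, map_pow, hζ0, zero_pow hp.out.ne_zero]
      simp
    obtain ⟨u, hu⟩ := hu
    have hu' : (u : B) - 1 = (ζ - 1) ^ p * c := by rw [hu]; ring
    exact ⟨u, (hmem u).mpr ⟨c, hu'⟩, hψ hu'⟩

end Steps

/-! ### Moving the levels prime to `p` into the interval `[e, p e)`. -/

section Indices

/-- A product over a predicate which holds at one more index. -/
def piSubtypeInsertEquiv {R : Type*} [Semiring R] {ι : Type*} [DecidableEq ι] (V : ι → Type*)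
    [∀ i, AddCommMonoid (V i)] [∀ i, Module R (V i)] {P P' : ι → Prop} (i : ι)
    (h : ∀ j, P j ↔ j = i ∨ P' j) (hi : ¬ P' i) :
    ((j : {j // P j}) → V j) ≃ₗ[R] V i × ((j : {j // P' j}) → V j) where
  toFun f := (f ⟨i, (h i).mpr (.inl rfl)⟩, fun j => f ⟨j, (h j).mpr (.inr j.2)⟩)
  invFun x j := if hj : (j : ι) = i then hj ▸ x.1 else x.2 ⟨j, ((h j).mp j.2).resolve_left hj⟩
  map_add' _ _ := rfl
  map_smul' _ _ := rfl
  left_inv f := by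
    ext ⟨j, hj⟩
    by_cases hji : j = i
    · subst hji; simp
    · simp [hji]
  right_inv x := by
    refine Prod.ext (by simp) (funext fun j => ?_)
    have : (j : ι) ≠ i := fun hj => hi (hj ▸ j.2)
    simp [this]

/-- The least `k` with `e ≤ p ^ k n` works: if `k > 0`, the previous multiple is below `e`. -/
lemma exists_mem_Ico_mul_pow {p : ℕ} (hp : 1 < p) {e n : ℕ} (hn0 : 0 < n) (hn : n < p * e) :
    ∃ k, e ≤ p ^ k * n ∧ p ^ k * n < p * e := by
  have hex : ∃ k, e ≤ p ^ k * n :=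
    ⟨e, (Nat.lt_pow_self hp).le.trans (Nat.le_mul_of_pos_right _ hn0)⟩
  classical
  refine ⟨Nat.find hex, Nat.find_spec hex, ?_⟩
  rcases hk : Nat.find hex with _ | k
  · simpa using hn
  · have := Nat.find_min hex (m := k) (by lia)
    rw [pow_succ', mul_assoc]
    exact Nat.mul_lt_mul_of_pos_left (by lia) (by lia)

/-- Two integers with the same prime-to-`p` part differ by a power of `p`, and the interval is too
short to contain both `m` and `p m`. -/
lemma ordCompl_injOn_Ico {p : ℕ} (hp : p.Prime) {e m m' : ℕ} (hm : e ≤ m) (hm' : m < p * e)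
    (hn : e ≤ m') (hn' : m' < p * e)
    (h : m / p ^ m.factorization p = m' / p ^ m'.factorization p) : m = m' := by
  wlog hle : m.factorization p ≤ m'.factorization p generalizing m m'
  · exact (this hn hn' hm hm' h.symm (by lia)).symm
  have h1 := Nat.ordProj_mul_ordCompl_eq_self m p
  have h2 := Nat.ordProj_mul_ordCompl_eq_self m' p
  obtain ⟨d, hd⟩ := Nat.exists_eq_add_of_le hle
  rw [← h, hd, pow_add, mul_comm (p ^ _) (p ^ d), mul_assoc, h1] at h2
  rcases d with _ | d
  · simpa using h2
  · exfalso
    have h3 : p * m ≤ p ^ (d + 1) * m :=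
      Nat.mul_le_mul_right _ (Nat.le_self_pow (by lia) p)
    have h4 : p * e ≤ p * m := Nat.mul_le_mul_left _ hm
    lia

/-- The prime-to-`p` part gives a bijection from `[e, p e)`, cut into `c` blocks of length `d`,
to the integers in `(0, p e)` prime to `p`. -/
lemma exists_equiv_blocks {p : ℕ} (hp : p.Prime) {e c d : ℕ} (he : 0 < e)
    (hcd : (p - 1) * e = c * d) :
    ∃ σ : Fin c × Fin d ≃ {j // 1 ≤ j ∧ j < p * e ∧ ¬ p ∣ j},
      ∀ x, ∃ k, p ^ k * (σ x : ℕ) = e + d * x.1 + x.2 := by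
  have hpe : p * e = e + c * d := by
    rw [← hcd]
    obtain ⟨q, rfl⟩ : ∃ q, p = q + 1 := ⟨p - 1, by have := hp.pos; lia⟩
    rw [Nat.add_sub_cancel]
    ring
  have hval (x : Fin c × Fin d) : e + d * x.1 + x.2 = e + (finProdFinEquiv x : ℕ) := by
    rw [finProdFinEquiv_apply_val]; ring
  have hlt (x : Fin c × Fin d) : e + d * x.1 + x.2 < p * e := by
    have := (finProdFinEquiv x).2
    rw [hval]; lia
  have hge (x : Fin c × Fin d) : e ≤ e + d * x.1 + x.2 := by lia
  let f : Fin c × Fin d → {j // 1 ≤ j ∧ j < p * e ∧ ¬ p ∣ j} := fun x =>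
    ⟨(e + d * x.1 + x.2) / p ^ (e + d * x.1 + x.2).factorization p,
      Nat.ordCompl_pos p (he.trans_le (hge x)).ne', (Nat.ordCompl_le _ _).trans_lt (hlt x),
      Nat.not_dvd_ordCompl hp (he.trans_le (hge x)).ne'⟩
  refine ⟨Equiv.ofBijective f ⟨fun x y h => ?_, ?_⟩,
    fun x => ⟨_, Nat.ordProj_mul_ordCompl_eq_self _ p⟩⟩
  · have := ordCompl_injOn_Ico hp (hge x) (hlt x) (hge y) (hlt y) (congrArg Subtype.val h)
    rw [hval, hval] at this
    exact finProdFinEquiv.injective (Fin.ext (by lia))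
  · rintro ⟨n, hn0, hn, hpn⟩
    obtain ⟨k, hk, hk'⟩ := exists_mem_Ico_mul_pow hp.one_lt hn0 hn
    let x := finProdFinEquiv.symm (⟨p ^ k * n - e, by lia⟩ : Fin (c * d))
    have hx : e + d * x.1 + x.2 = p ^ k * n := by
      rw [hval]
      simp only [x, Equiv.apply_symm_apply]
      lia
    refine ⟨x, Subtype.ext ?_⟩
    simp only [f, hx]
    have hfac : (p ^ k * n).factorization p = k := by
      rw [Nat.factorization_mul (pow_ne_zero _ hp.ne_zero) (by lia), hp.factorization_pow]
      simp [Nat.factorization_eq_zero_of_not_dvd hpn]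
    rw [hfac, Nat.mul_div_cancel_left _ (pow_pos hp.pos _)]

end Indices

section AsModule

variable {p : ℕ} [NeZero p] {G : Type*} [Group G] {V W : Type*} [AddCommGroup V]
  [Module (ZMod p) V] [AddCommGroup W] [Module (ZMod p) W]

omit [NeZero p] in
lemma of_smul_asModule (ρ : Representation (ZMod p) G V) (g : G) (x : ρ.asModule) :
    MonoidAlgebra.of (ZMod p) G g • x = ρ.asModuleEquiv.symm (ρ g (ρ.asModuleEquiv x)) := by
  rw [Representation.asModuleEquiv_symm_map_rho, LinearEquiv.symm_apply_apply]

/-- An additive isomorphism commuting with `G` gives an isomorphism of `𝔽_p[G]`-modules. -/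
def asModuleEquivOfEquivariant (ρ : Representation (ZMod p) G V) (ρ' : Representation (ZMod p) G W)
    (f : V →+ W) (hf : ∀ g x, f (ρ g x) = ρ' g (f x)) (hb : Function.Bijective f) :
    ρ.asModule ≃ₗ[(ZMod p)[G]] ρ'.asModule :=
  linearEquivOfEquivariant (M := ρ.asModule) (N := ρ'.asModule) f (fun g x =>
    (congrArg f (of_smul_asModule ρ g x)).trans
      ((hf g x).trans (of_smul_asModule ρ' g (f x)).symm)) hb

end AsModule

/-! ### Frobenius between graded pieces. -/

section Frobenius

variable (p : ℕ) [hp : Fact p.Prime] {B : Type*} [CommRing B] [IsDomain B]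
  [IsLocalRing B] [Finite (ResidueField B)] [Algebra (ZMod p) (ResidueField B)]
  {G : Type*} [Group G] [MulSemiringAction G B]
  {ϖ : B} (hϖ : ϖ ≠ 0) {χ : G → B} (hχ : ∀ g, g • ϖ = χ g * ϖ)

include hp in
/-- Frobenius is an isomorphism from the graded piece of level `i` to that of level `p i`. -/
lemma nonempty_gradedModule_equiv_mul (i : ℕ) :
    Nonempty (gradedModule p hϖ hχ i ≃ₗ[(ZMod p)[G]] gradedModule p hϖ hχ (p * i)) := by
  have : CharP (ResidueField B) p :=
    charP_of_injective_algebraMap (algebraMap (ZMod p) (ResidueField B)).injective p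
  refine ⟨asModuleEquivOfEquivariant _ _ (frobenius (ResidueField B) p).toAddMonoidHom
    (fun g x => ?_) (PerfectRing.bijective_frobenius (R := ResidueField B) (p := p))⟩
  change (residue B (χ g) ^ i * g • x) ^ p = residue B (χ g) ^ (p * i) * g • x ^ p
  rw [mul_pow, ← pow_mul, mul_comm i p, smul_pow']

include hp in
lemma nonempty_gradedModule_equiv_pow_mul (i k : ℕ) :
    Nonempty (gradedModule p hϖ hχ i ≃ₗ[(ZMod p)[G]] gradedModule p hϖ hχ (p ^ k * i)) := by
  induction k with
  | zero => rw [pow_zero, one_mul]; exact ⟨LinearEquiv.refl _ _⟩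
  | succ k ih =>
    rw [pow_succ', mul_assoc]
    obtain ⟨f⟩ := ih
    obtain ⟨g⟩ := nonempty_gradedModule_equiv_mul p hϖ hχ (p ^ k * i)
    exact ⟨f.trans g⟩

end Frobenius

/-! ### Splitting the whole filtration. -/

section Decomposition

variable {p : ℕ} [hp : Fact p.Prime] {B : Type*} [CommRing B] [IsDomain B]
  [IsDiscreteValuationRing B] [HenselianLocalRing B] [CharP (ResidueField B) p]
  [Finite (ResidueField B)] [Algebra (ZMod p) (ResidueField B)]
  {G : Type*} [Group G] [MulSemiringAction G B]
  {ζ : B} (hζ : IsPrimitiveRoot ζ p) {ϖ : B} (hϖ : Irreducible ϖ)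
  {χ : G → B} (hχ : ∀ g, g • ϖ = χ g * ϖ) {e : ℕ} (he0 : 0 < e) (he : Associated (ζ - 1) (ϖ ^ e))
  [∀ i, Module.Projective (ZMod p)[G] (gradedModule p hϖ.ne_zero hχ i)]
  {M : Type*} [AddCommGroup M] [Module (ZMod p)[G] M] (π : Bˣ →* Multiplicative M)
  (hπ : ∀ g u, (π (g • u)).toAdd = MonoidAlgebra.of (ZMod p) G g • (π u).toAdd)
  (hker : ∀ u, π u = 1 ↔ ∃ x : Bˣ, x ^ p = u)
  {N : Type*} [AddCommGroup N] [Module (ZMod p)[G] N] (τ : ZMod p →+ N)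
  (hτ : Function.Bijective τ) (hτG : ∀ (g : G) (n : ℕ), g • ζ = ζ ^ n →
      ∀ a, MonoidAlgebra.of (ZMod p) G g • τ a = τ (n * a))

include hζ he0 he hker hτ hτG

/-- The image of the unit filtration is the sum of its graded pieces. -/
lemma nonempty_imageFiltration_equiv_prod_pi {i : ℕ} (hi0 : 0 < i) (hi : i ≤ p * e) :
    Nonempty (imageFiltration hχ π hπ i ≃ₗ[(ZMod p)[G]]
      N × ((j : {j // i ≤ j ∧ j < p * e ∧ ¬ p ∣ j}) → gradedModule p hϖ.ne_zero hχ j)) := by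
  obtain ⟨d, hd⟩ := Nat.exists_eq_add_of_le hi
  -- Descending induction from level `p e`, where only `N` is left. A level divisible by `p` adds
  -- nothing; one prime to `p` splits off its projective graded piece.
  induction d generalizing i with
  | zero =>
    obtain rfl : i = p * e := by lia
    obtain ⟨f⟩ := nonempty_imageFiltration_equiv hζ hϖ hχ he π hπ hker he0 τ hτ hτG
    have : IsEmpty {j // p * e ≤ j ∧ j < p * e ∧ ¬ p ∣ j} := ⟨fun j => by lia⟩
    exact ⟨f.trans (LinearEquiv.prodUnique).symm⟩
  | succ d ih =>
    obtain ⟨f⟩ := ih (i := i + 1) (by lia) (by lia) (by lia)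
    by_cases hpi : p ∣ i
    · have h1 : imageFiltration hχ π hπ i = imageFiltration hχ π hπ (i + 1) := by
        obtain ⟨j, rfl⟩ := hpi
        exact imageFiltration_mul_eq hζ hϖ hχ he π hπ hker
          (Nat.pos_of_mul_pos_left hi0) (Nat.lt_of_mul_lt_mul_left (a := p) (by lia))
      have h2 : (fun j => i ≤ j ∧ j < p * e ∧ ¬ p ∣ j) =
          (fun j => i + 1 ≤ j ∧ j < p * e ∧ ¬ p ∣ j) := by
        ext j
        refine ⟨fun ⟨h1, h2, h3⟩ => ⟨?_, h2, h3⟩, fun ⟨h1, h2, h3⟩ => ⟨by lia, h2, h3⟩⟩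
        exact lt_of_le_of_ne h1 (fun h => h3 (h ▸ hpi))
      rw [h1]
      change Nonempty (_ ≃ₗ[(ZMod p)[G]] N × ((j : Subtype fun j => i ≤ j ∧ j < p * e ∧ ¬ p ∣ j) →
        gradedModule p hϖ.ne_zero hχ j))
      rw [h2]
      exact ⟨f⟩
    · obtain ⟨g⟩ := nonempty_imageFiltration_equiv_prod hζ hϖ hχ he π hπ hker hi0 (by lia) hpi
      let s := piSubtypeInsertEquiv (R := (ZMod p)[G]) (fun j => gradedModule p hϖ.ne_zero hχ j)
        (P := fun j => i ≤ j ∧ j < p * e ∧ ¬ p ∣ j)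
        (P' := fun j => i + 1 ≤ j ∧ j < p * e ∧ ¬ p ∣ j) i
        (fun j => by
          constructor
          · rintro ⟨h1, h2, h3⟩
            rcases h1.eq_or_lt with h | h
            · exact .inl h.symm
            · exact .inr ⟨h, h2, h3⟩
          · rintro (rfl | ⟨h1, h2, h3⟩)
            · exact ⟨le_rfl, by lia, hpi⟩
            · exact ⟨by lia, h2, h3⟩) (by lia)
      exact ⟨g.trans (((f.prodCongr (LinearEquiv.refl _ _)).trans
        (LinearEquiv.prodAssoc _ _ _ _)).trans ((LinearEquiv.refl _ N).prodCongr
          ((LinearEquiv.prodComm _ _ _).trans s.symm)))⟩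

/-- The image of the principal units, in terms of graded pieces of consecutive levels. -/
lemma nonempty_imageFiltration_one_equiv {c d : ℕ} (hcd : (p - 1) * e = c * d) :
    Nonempty (imageFiltration hχ π hπ 1 ≃ₗ[(ZMod p)[G]]
      N × ((a : Fin c) → (b : Fin d) → gradedModule p hϖ.ne_zero hχ (e + d * a + b))) := by
  obtain ⟨f⟩ := nonempty_imageFiltration_equiv_prod_pi hζ hϖ hχ he0 he π hπ hker τ hτ hτG one_pos
    (Nat.mul_pos hp.out.pos he0)
  obtain ⟨σ, hσ⟩ := exists_equiv_blocks hp.out he0 hcd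
  -- The two levels differ by a factor `p ^ k`, hence iterated Frobenius identifies their pieces.
  have hV (x : Fin c × Fin d) : Nonempty (gradedModule p hϖ.ne_zero hχ (σ x : ℕ) ≃ₗ[(ZMod p)[G]]
      gradedModule p hϖ.ne_zero hχ (e + d * x.1 + x.2)) := by
    obtain ⟨k, hk⟩ := hσ x
    rw [← hk]
    exact nonempty_gradedModule_equiv_pow_mul p hϖ.ne_zero hχ _ k
  exact ⟨f.trans ((LinearEquiv.refl _ N).prodCongr (((LinearEquiv.piCongrLeft' (ZMod p)[G]
    (fun j : {j // 1 ≤ j ∧ j < p * e ∧ ¬ p ∣ j} => gradedModule p hϖ.ne_zero hχ j)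
      ((Equiv.sigmaEquivProd (Fin c) (Fin d)).trans σ).symm).trans
      (LinearEquiv.piCongrRight fun x => (hV (x.1, x.2)).some)).trans
        (LinearEquiv.piCurry (ZMod p)[G]
        (fun (a : Fin c) (b : Fin d) => gradedModule p hϖ.ne_zero hχ (e + d * a + b)))))⟩

end Decomposition

/-! ### Blocks of consecutive pieces and the group algebra. -/

section NormalBasis

variable (k : Type*) {l : Type*} [Field k] [Field l] [Algebra k l] [FiniteDimensional k l]
  {G : Type*} [Group G] [MulSemiringAction G l] [SMulCommClass G k l]
  (s : G ⧸ (MulSemiringAction.toRingAut G l).ker →* G)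
  (hs : (QuotientGroup.mk' (MulSemiringAction.toRingAut G l).ker).comp s = MonoidHom.id _)

include hs

lemma smul_section_injective {q q' : G ⧸ (MulSemiringAction.toRingAut G l).ker}
    (h : ∀ x : l, s q • x = s q' • x) : q = q' := by
  have h1 (q) : QuotientGroup.mk' _ (s q) = q := DFunLike.congr_fun hs q
  rw [← h1 q, ← h1 q']
  refine (QuotientGroup.eq).mpr ?_
  rw [MonoidHom.mem_ker]
  refine RingEquiv.ext fun x => ?_
  change ((s q)⁻¹ * s q') • x = x
  rw [mul_smul, ← h, inv_smul_smul]

/-- The normal basis theorem, restricted to the distinct automorphisms given by the section.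
Spanning is not needed: a dimension count supplies bijectivity later. -/
lemma exists_linearIndependent_section : ∃ α : l, LinearIndependent k fun q => s q • α := by
  obtain ⟨α, hα⟩ := exists_linearIndependent_algEquiv_apply k l
  refine ⟨α, hα.comp (fun q => MulSemiringAction.toAlgEquiv k l (s q)) fun q q' h => ?_⟩
  exact smul_section_injective s hs fun x => DFunLike.congr_fun h x

end NormalBasis

section Block

variable (p : ℕ) [Fact p.Prime] (k : Type*) [Field k] {B : Type*} [CommRing B] [IsDomain B]
  [IsLocalRing B] [Algebra (ZMod p) (ResidueField B)]
  [Algebra k (ResidueField B)] [FiniteDimensional k (ResidueField B)]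
  {G : Type*} [Group G] [MulSemiringAction G B] [SMulCommClass G k (ResidueField B)]
  {ϖ : B} (hϖ : ϖ ≠ 0) {χ : G → B} (hχ : ∀ g, g • ϖ = χ g * ϖ)

/-- The graded pieces, as representations over a field fixed by `G`. -/
def gradedRepOver (i : ℕ) : Representation k G (ResidueField B) where
  toFun g :=
    { toFun := gradedRep p hϖ hχ i g
      map_add' := map_add _
      map_smul' := fun a x => by
        simp only [gradedRep_apply, smul_comm g a x, mul_smul_comm, RingHom.id_apply] }
  map_one' := LinearMap.ext fun x =>
    DFunLike.congr_fun (map_one (gradedRep p hϖ hχ i)) x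
  map_mul' g h := LinearMap.ext fun x =>
    DFunLike.congr_fun (map_mul (gradedRep p hϖ hχ i) g h) x

/-- The map from the group algebra to a block of `d` consecutive graded pieces defined by an
element of the residue field. -/
def blockMap (a d : ℕ) (α : ResidueField B) : k[G] →ₗ[k] (Fin d → ResidueField B) :=
  LinearMap.pi fun b => (LinearMap.applyₗ α).comp
    (gradedRepOver p k hϖ hχ (a + b)).asAlgebraHom.toLinearMap

omit [FiniteDimensional k (ResidueField B)] in
lemma blockMap_of_mul (a d : ℕ) (α : ResidueField B) (g : G) (x : k[G]) (b : Fin d) :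
    blockMap p k hϖ hχ a d α (MonoidAlgebra.of k G g * x) b =
      gradedRep p hϖ hχ (a + b) g (blockMap p k hϖ hχ a d α x b) := by
  change (gradedRepOver p k hϖ hχ (a + b)).asAlgebraHom _ α = _
  rw [map_mul, Representation.asAlgebraHom_of]
  rfl

omit [FiniteDimensional k (ResidueField B)] in
lemma blockMap_apply [Fintype G] (a d : ℕ) (α : ResidueField B) (x : k[G]) (b : Fin d) :
    blockMap p k hϖ hχ a d α x b =
      ∑ g, x.coeff g • (residue B (χ g) ^ (a + b : ℕ) * g • α) := by
  change (gradedRepOver p k hϖ hχ (a + b)).asAlgebraHom x α = _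
  rw [Representation.asAlgebraHom_def, MonoidAlgebra.lift_apply, Finsupp.sum_fintype _ _ (by simp),
    LinearMap.sum_apply]
  rfl

variable (s : G ⧸ (MulSemiringAction.toRingAut G (ResidueField B)).ker →* G)
  (hs : (QuotientGroup.mk' (MulSemiringAction.toRingAut G (ResidueField B)).ker).comp s =
    MonoidHom.id _)

include hs in
omit [IsDomain B] in
-- The semidirect decomposition of `G`, used to split sums over `G` into an inertia part and a
-- residual part.
lemma bijective_mul_section : Function.Bijective
    fun x : (MulSemiringAction.toRingAut G (ResidueField B)).ker ×
      (G ⧸ (MulSemiringAction.toRingAut G (ResidueField B)).ker) => (x.1 : G) * s x.2 := by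
  have h1 (q) : QuotientGroup.mk' _ (s q) = q := DFunLike.congr_fun hs q
  constructor
  · rintro ⟨t, q⟩ ⟨t', q'⟩ h
    have h2 := congrArg (QuotientGroup.mk' (MulSemiringAction.toRingAut G (ResidueField B)).ker) h
    simp only [map_mul, h1] at h2
    have ht (t : (MulSemiringAction.toRingAut G (ResidueField B)).ker) :
        QuotientGroup.mk' (MulSemiringAction.toRingAut G (ResidueField B)).ker t = 1 :=
      (QuotientGroup.eq_one_iff _).mpr t.2
    rw [ht, ht, one_mul, one_mul] at h2
    subst h2
    exact Prod.ext (Subtype.ext (mul_right_cancel h)) rfl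
  · intro g
    let q := QuotientGroup.mk' (MulSemiringAction.toRingAut G (ResidueField B)).ker g
    have hq : g * (s q)⁻¹ ∈ (MulSemiringAction.toRingAut G (ResidueField B)).ker := by
      rw [← QuotientGroup.eq_one_iff]
      change QuotientGroup.mk' _ _ = 1
      rw [map_mul, map_inv, h1, mul_inv_cancel]
    exact ⟨⟨⟨_, hq⟩, q⟩, by simp⟩

variable [Finite G] {d : ℕ}
  (hd : Nat.card (MulSemiringAction.toRingAut G (ResidueField B)).ker = d)
  (hχs : ∀ q, residue B (χ (s q)) = 1)
  (hχt : ∀ t ∈ (MulSemiringAction.toRingAut G (ResidueField B)).ker, residue B (χ t) = 1 → t = 1)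
  (hχ0 : ∀ g, residue B (χ g) ≠ 0)
  (hcard : Nat.card G = d * Module.finrank k (ResidueField B))

include hs hd hχs hχt hχ0

omit [FiniteDimensional k (ResidueField B)] in
-- For `x` in the kernel, put `f t = ∑ q, x (t s(q)) s(q) α` for `t ∈ T`. As `χ` is trivial on the
-- section modulo `ϖ`, the `b`-th component reads `∑ t, χ(t) ^ (a + b) f t = 0`. There are `d = |T|`
-- such equations and the `χ(t)` are distinct and nonzero, so a Vandermonde determinant gives `f =
-- 0`; independence of the `s(q) α` then gives `x = 0`.
lemma blockMap_injective (a : ℕ) {α : ResidueField B}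
    (hα : LinearIndependent k fun q => s q • α) :
    Function.Injective (blockMap p k hϖ hχ a d α) := by
  classical
  have := Fintype.ofFinite G
  let T := (MulSemiringAction.toRingAut G (ResidueField B)).ker
  have := Fintype.ofFinite T
  have := Fintype.ofFinite (G ⧸ T)
  have hT (t : T) (x : ResidueField B) : (t : G) • x = x :=
    congrArg (fun f : ResidueField B ≃+* ResidueField B => f x) (MonoidHom.mem_ker.mp t.2)
  have hχmul (t : T) (g : G) : residue B (χ (t * g)) = residue B (χ t) * residue B (χ g) := by
    rw [cocycle_mul hϖ hχ, map_mul, ResidueField.residue_smul, hT]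
  have hχinj : Function.Injective fun t : T => residue B (χ t) := by
    intro t t' h
    have h1 : residue B (χ (t * (t'⁻¹ : T))) = 1 := by
      have h2 := hχmul t' (t'⁻¹ : T)
      rw [Subgroup.coe_inv, mul_inv_cancel, cocycle_one hϖ hχ, map_one] at h2
      have h : residue B (χ t) = residue B (χ t') := h
      rw [hχmul, h, h2, Subgroup.coe_inv]
    have h2 := hχt _ (T.mul_mem t.2 (t'⁻¹).2) h1
    exact Subtype.ext (by rwa [Subgroup.coe_inv, mul_inv_eq_one] at h2)
  let σ : Fin d ≃ T := (Finite.equivFinOfCardEq hd).symm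
  rw [injective_iff_map_eq_zero]
  intro x hx
  let f : T → ResidueField B := fun t => ∑ q, x.coeff (t * s q) • s q • α
  have hsum (b : Fin d) : ∑ t : T, residue B (χ t) ^ (a + b : ℕ) * f t = 0 := by
    have h := congrFun hx b
    rw [blockMap_apply, ← (Equiv.ofBijective _ (bijective_mul_section s hs)).sum_comp,
      Fintype.sum_prod_type] at h
    rw [← Pi.zero_apply (M := fun _ => ResidueField B) b, ← h]
    refine Finset.sum_congr rfl fun t _ => ?_
    rw [Finset.mul_sum]
    refine Finset.sum_congr rfl fun q _ => ?_
    rw [Equiv.ofBijective_apply, hχmul, hχs, mul_one, mul_smul_comm, mul_smul, hT]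
  have hv : (fun j : Fin d => residue B (χ (σ j)) ^ a * f (σ j)) = 0 := by
    refine Matrix.eq_zero_of_forall_pow_sum_mul_pow_eq_zero
      (f := fun j => residue B (χ (σ j))) (hχinj.comp σ.injective) fun b => ?_
    rw [← hsum b, ← σ.sum_comp]
    refine Finset.sum_congr rfl fun j _ => ?_
    rw [pow_add]
    ring
  have hf (t : T) : f t = 0 := by
    have h := congrFun hv (σ.symm t)
    simp only [Equiv.apply_symm_apply, Pi.zero_apply] at h
    exact (mul_eq_zero.mp h).resolve_left (pow_ne_zero _ (hχ0 _))
  refine MonoidAlgebra.ext (Finsupp.ext fun g => ?_)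
  obtain ⟨⟨t, q⟩, rfl⟩ := (bijective_mul_section s hs).2 g
  exact Fintype.linearIndependent_iff.mp hα _ (hf t) q

include hcard

lemma blockMap_bijective (a : ℕ) {α : ResidueField B}
    (hα : LinearIndependent k fun q => s q • α) :
    Function.Bijective (blockMap p k hϖ hχ a d α) := by
  have hinj := blockMap_injective p k hϖ hχ s hs hd hχs hχt hχ0 a hα
  have := Fintype.ofFinite G
  have : FiniteDimensional k k[G] := Module.Finite.of_injective _ hinj
  refine ⟨hinj, (LinearMap.injective_iff_surjective_of_finrank_eq_finrank ?_).mp hinj⟩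
  have h1 : Module.finrank k k[G] = Nat.card G := by
    rw [(MonoidAlgebra.coeffLinearEquiv k).finrank_eq, Module.finrank_finsupp_self,
      Nat.card_eq_fintype_card]
  rw [h1, hcard, Module.finrank_pi_fintype, Finset.sum_const, Finset.card_univ, Fintype.card_fin,
    smul_eq_mul]

/-- A block of `d` consecutive graded pieces, where `d` is the order of the inertia group, is
isomorphic to the group algebra over the residue field. -/
lemma exists_block_equiv (a : ℕ) :
    ∃ Φ : k[G] →+ ((b : Fin d) → gradedModule p hϖ hχ (a + b)), Function.Bijective Φ ∧
      ∀ g x, Φ (MonoidAlgebra.of k G g * x) = MonoidAlgebra.of (ZMod p) G g • Φ x := by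
  obtain ⟨α, hα⟩ := exists_linearIndependent_section k s hs
  refine ⟨(blockMap p k hϖ hχ a d α).toAddMonoidHom,
    blockMap_bijective p k hϖ hχ s hs hd hχs hχt hχ0 hcard a hα, fun g x => funext fun b => ?_⟩
  refine (blockMap_of_mul p k hϖ hχ a d α g x b).trans ?_
  exact (of_smul_asModule (gradedRep p hϖ hχ (a + b)) g (blockMap p k hϖ hχ a d α x b)).symm

end Block

/-! ### From `𝔽_p[G]` to `k[G]`. -/

section BaseChange

variable {p : ℕ} {k : Type*} [Field k] [Fact p.Prime] [Algebra (ZMod p) k]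
  {G : Type*} [Group G]

/-- A basis of `k` over `𝔽_p` gives a basis of `k[G]` over `𝔽_p[G]`. -/
lemma exists_groupAlgebra_equiv {ι : Type*} [Fintype ι] (b : Module.Basis ι (ZMod p) k) :
    ∃ Ψ : (ι → (ZMod p)[G]) →+ k[G], Function.Bijective Ψ ∧
      ∀ g x, Ψ (MonoidAlgebra.of (ZMod p) G g • x) = MonoidAlgebra.of k G g * Ψ x := by
  let Ψ : (ι → (ZMod p)[G]) →+ k[G] :=
    ∑ i, ((AddMonoidHom.mulRight (MonoidAlgebra.single 1 (b i))).comp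
    (MonoidAlgebra.mapRingHom G (algebraMap (ZMod p) k)).toAddMonoidHom).comp
      (Pi.evalAddMonoidHom (fun _ : ι => (ZMod p)[G]) i)
  have hΨ (x) : Ψ x = ∑ i, MonoidAlgebra.mapRingHom G (algebraMap (ZMod p) k) (x i) *
      MonoidAlgebra.single 1 (b i) := by
    simp only [Ψ, AddMonoidHom.finsetSum_apply]
    rfl
  have hcoeff (x) (g : G) : (Ψ x).coeff g = b.equivFun.symm (fun i => (x i).coeff g) := by
    rw [hΨ, b.equivFun_symm_apply, MonoidAlgebra.coeff_sum, Finsupp.finsetSum_apply]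
    refine Finset.sum_congr rfl fun i _ => ?_
    simp [Algebra.smul_def]
  refine ⟨Ψ, ⟨fun x y h => ?_, fun y => ?_⟩, fun g x => ?_⟩
  · refine funext fun i => MonoidAlgebra.ext (Finsupp.ext fun g => ?_)
    have h1 := hcoeff x g
    rw [h, hcoeff] at h1
    exact (congrFun (b.equivFun.symm.injective h1) i).symm
  · refine ⟨fun i => MonoidAlgebra.ofCoeff (y.coeff.mapRange (fun c => b.equivFun c i) (by simp)),
      MonoidAlgebra.ext (Finsupp.ext fun g => ?_)⟩
    rw [hcoeff]
    exact b.equivFun.symm_apply_apply _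
  · rw [hΨ, hΨ, Finset.mul_sum]
    refine Finset.sum_congr rfl fun i _ => ?_
    rw [Pi.smul_apply, smul_eq_mul, map_mul, mul_assoc]
    congr 1
    simp

end BaseChange

/-! ### Consequences of splitness and tameness for the uniformizer. -/

section Uniformizer

variable {B : Type*} [CommRing B] [IsDomain B]
  {G : Type*} [Group G] [MulSemiringAction G B] {ϖ : B}

omit [IsDomain B] in
/-- If the action of `G` on the residue field is split, there is a uniformizer fixed by the
section. -/
lemma exists_irreducible_smul_section_eq [IsLocalRing B] [Finite G] (hϖ : Irreducible ϖ) {χ : G → B}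
    (hχ : ∀ g, g • ϖ = χ g * ϖ) (hχ0 : ∀ g, residue B (χ g) ≠ 0)
    (s : G ⧸ (MulSemiringAction.toRingAut G (ResidueField B)).ker →* G)
    (hs : (QuotientGroup.mk' (MulSemiringAction.toRingAut G (ResidueField B)).ker).comp s =
      MonoidHom.id _) :
    ∃ ϖ' : B, Irreducible ϖ' ∧ ∀ q, s q • ϖ' = ϖ' := by
  classical
  have := Fintype.ofFinite (G ⧸ (MulSemiringAction.toRingAut G (ResidueField B)).ker)
  let F (q : G ⧸ (MulSemiringAction.toRingAut G (ResidueField B)).ker) :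
      ResidueField B →* ResidueField B :=
    (MulSemiringAction.toRingHom G (ResidueField B) (s q)).toMonoidHom
  have hF : Function.Injective F := fun q q' h =>
    smul_section_injective s hs fun x => DFunLike.congr_fun h x
  -- As in Hilbert's theorem 90: Dedekind's independence of characters provides `β` for which the
  -- twisted sum is a unit. The sum of the translates of `β ϖ` under the section is this unit times
  -- `ϖ`, and is visibly fixed.
  have hlin := (linearIndependent_monoidHom (ResidueField B) (ResidueField B)).comp F hF
  obtain ⟨β, hβ⟩ : ∃ β : B, residue B (∑ q, χ (s q) * s q • β) ≠ 0 := by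
    by_contra! h
    refine hχ0 (s 1) (Fintype.linearIndependent_iff.mp hlin (fun q => residue B (χ (s q)))
      (funext fun x => ?_) 1)
    obtain ⟨β, rfl⟩ := residue_surjective x
    refine Eq.trans ?_ (h β)
    rw [map_sum, Finset.sum_apply]
    refine Finset.sum_congr rfl fun q _ => ?_
    rw [map_mul, ResidueField.residue_smul]
    rfl
  rw [residue_ne_zero_iff_isUnit] at hβ
  have hsum : ∑ q, s q • (β * ϖ) = (∑ q, χ (s q) * s q • β) * ϖ := by
    rw [Finset.sum_mul]
    refine Finset.sum_congr rfl fun q _ => ?_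
    rw [smul_mul', hχ]
    ring
  refine ⟨∑ q, s q • (β * ϖ), ?_, fun q => ?_⟩
  · rw [hsum]
    exact (irreducible_isUnit_mul hβ).mpr hϖ
  · rw [Finset.smul_sum,
      ← Equiv.sum_comp (Equiv.mulLeft q) (fun q => s q • (β * ϖ))]
    refine Finset.sum_congr rfl fun q' _ => ?_
    rw [Equiv.coe_mulLeft, map_mul, mul_smul]

/-- An automorphism of order invertible in the residue field which acts trivially on the residue
field and on the cotangent space is trivial. -/
lemma eq_one_of_tame [IsDiscreteValuationRing B] [FaithfulSMul G B] (hϖ : Irreducible ϖ)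
    {χ : G → B} (hχ : ∀ g, g • ϖ = χ g * ϖ) {t : G} {m : ℕ} (htm : t ^ m = 1)
    (hm : (m : ResidueField B) ≠ 0) (ht : ∀ x : ResidueField B, t • x = x)
    (htχ : residue B (χ t) = 1) : t = 1 := by
  have hgr (n : ℕ) (c : B) : ϖ ^ (n + 1) ∣ t • (ϖ ^ n * c) - ϖ ^ n * c := by
    rw [smul_mul', smul_pow', hχ, mul_pow,
      show χ t ^ n * ϖ ^ n * t • c - ϖ ^ n * c = ϖ ^ n * (χ t ^ n * t • c - c) by ring, pow_succ]
    refine mul_dvd_mul_left _ ?_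
    rw [← residue_eq_zero_iff_dvd hϖ, map_sub, map_mul, map_pow, htχ, ResidueField.residue_smul, ht,
      one_pow, one_mul, sub_self]
  -- If `t x = x + ϖ ^ n c`, iteration gives `t ^ j x ≡ x + j ϖ ^ n c` modulo `ϖ ^ (n + 1)`. Taking
  -- `j = m` yields `m c ≡ 0`, and `m` is invertible, so `ϖ ∣ c`.
  have key (n : ℕ) : ∀ x : B, ϖ ^ n ∣ t • x - x := by
    induction n with
    | zero => simp
    | succ n ih =>
      intro x
      obtain ⟨c, hc⟩ := ih x
      have hj (j : ℕ) : ϖ ^ (n + 1) ∣ t ^ j • x - x - j * (ϖ ^ n * c) := by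
        induction j with
        | zero => simp
        | succ j ihj =>
          obtain ⟨y, hy⟩ := ihj
          obtain ⟨z, hz⟩ := hgr n c
          refine ⟨j * z + χ t ^ (n + 1) * t • y, ?_⟩
          have h1 : t ^ j • x = x + j * (ϖ ^ n * c) + ϖ ^ (n + 1) * y := by
            linear_combination hy
          have h2 : t • (j : B) = j := map_natCast (MulSemiringAction.toRingHom G B t) j
          rw [pow_succ', mul_smul, h1, smul_add, smul_add, smul_mul' t (j : B), h2,
            smul_mul' t (ϖ ^ (n + 1)), smul_pow', hχ]
          push_cast
          linear_combination hc + j * hz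
      have h1 := hj m
      rw [htm, one_smul, sub_self, zero_sub, dvd_neg, pow_succ, mul_left_comm,
        mul_dvd_mul_iff_left (pow_ne_zero _ hϖ.ne_zero), ← residue_eq_zero_iff_dvd hϖ, map_mul,
        map_natCast] at h1
      rw [hc, pow_succ]
      exact mul_dvd_mul_left _ ((residue_eq_zero_iff_dvd hϖ _).mp
        ((mul_eq_zero.mp h1).resolve_left hm))
  refine FaithfulSMul.eq_of_smul_eq_smul (α := B) fun x => ?_
  rw [one_smul]
  by_contra hx
  obtain ⟨n, hn⟩ := IsDiscreteValuationRing.associated_pow_irreducible (sub_ne_zero.mpr hx) hϖ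
  have h1 := (key (n + 1) x).trans hn.dvd
  rw [pow_dvd_pow_iff hϖ.ne_zero hϖ.not_isUnit] at h1
  lia

end Uniformizer

/-! ### Projectivity of the pieces, and assembly over an abstract ring. -/

section Projective

lemma projective_of_pi {R : Type*} [Ring R] {d : ℕ} (hd : 0 < d) (V : ℕ → Type*)
    [∀ i, AddCommGroup (V i)] [∀ i, Module R (V i)]
    (h : Module.Projective R ((b : Fin d) → V b)) : Module.Projective R (V 0) := by
  let i : V 0 →ₗ[R] ((b : Fin d) → V b) := LinearMap.single R (fun b : Fin d => V b) ⟨0, hd⟩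
  let π : ((b : Fin d) → V b) →ₗ[R] V 0 := LinearMap.proj (⟨0, hd⟩ : Fin d)
  exact Module.Projective.of_split i π (LinearMap.ext fun x =>
    Pi.single_eq_same (M := fun b : Fin d => V b) (⟨0, hd⟩ : Fin d) x)

variable (p : ℕ) [Fact p.Prime] (k : Type*) [Field k] [Algebra (ZMod p) k]
  [FiniteDimensional (ZMod p) k] {B : Type*} [CommRing B] [IsDomain B]
  [IsLocalRing B] [Algebra (ZMod p) (ResidueField B)]
  {G : Type*} [Group G] [MulSemiringAction G B]
  {ϖ : B} (hϖ : ϖ ≠ 0) {χ : G → B} (hχ : ∀ g, g • ϖ = χ g * ϖ)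

/-- The first graded piece of a block isomorphic to the group algebra is projective. -/
lemma projective_gradedModule {a d : ℕ} (hd : 0 < d)
    (Φ : k[G] →+ ((b : Fin d) → gradedModule p hϖ hχ (a + b))) (hΦ : Function.Bijective Φ)
    (hΦG : ∀ g x, Φ (MonoidAlgebra.of k G g * x) = MonoidAlgebra.of (ZMod p) G g • Φ x) :
    Module.Projective (ZMod p)[G] (gradedModule p hϖ hχ a) := by
  obtain ⟨Ψ, hΨ, hΨG⟩ := exists_groupAlgebra_equiv (G := G) (Module.finBasis (ZMod p) k)
  let f := linearEquivOfEquivariant (p := p) (G := G) (Φ.comp Ψ)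
    (fun g x => (congrArg Φ (hΨG g x)).trans (hΦG g (Ψ x))) (hΦ.comp hΨ)
  exact projective_of_pi hd (fun b => gradedModule p hϖ hχ (a + b)) (Module.Projective.of_equiv f)

end Projective

section Abstract

variable {p : ℕ} [hp : Fact p.Prime] {B : Type*} [CommRing B] [IsDomain B]
  [IsDiscreteValuationRing B] [CharP (ResidueField B) p] [Algebra (ZMod p) (ResidueField B)]
  {G : Type*} [Group G] [MulSemiringAction G B]
  {ζ : B} (hζ : IsPrimitiveRoot ζ p)

include hζ in
omit [Algebra (ZMod p) (ResidueField B)] in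
/-- The ramification index of `p` is `p - 1` times the valuation of `ζ - 1`. -/
lemma exists_associated_primitiveRoot_sub_one {ϖ : B} (hϖ : Irreducible ϖ) {n : ℕ}
    (hn : Associated (p : B) (ϖ ^ n)) :
    ∃ e, 0 < e ∧ Associated (ζ - 1) (ϖ ^ e) ∧ (p - 1) * e = n := by
  obtain ⟨e, he⟩ := IsDiscreteValuationRing.associated_pow_irreducible
    (primitiveRoot_sub_one_ne_zero hζ) hϖ
  refine ⟨e, Nat.pos_of_ne_zero ?_, he, ?_⟩
  · rintro rfl
    rw [pow_zero, associated_one_iff_isUnit, ← residue_ne_zero_iff_isUnit] at he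
    exact he (by rw [map_sub, residue_primitiveRoot hζ, map_one, sub_self])
  · obtain ⟨v, hv, hv'⟩ := exists_natCast_eq_mul_pow hζ
    have hvu : IsUnit v := by
      rw [← residue_ne_zero_iff_isUnit, hv']
      exact neg_ne_zero.mpr one_ne_zero
    have h1 : Associated (p : B) ((ζ - 1) ^ (p - 1)) := by
      rw [hv]
      exact associated_unit_mul_left _ _ hvu
    have h2 : Associated (ϖ ^ ((p - 1) * e)) (ϖ ^ n) := by
      rw [mul_comm, pow_mul]
      exact (he.pow_pow.symm.trans h1.symm).trans hn
    refine le_antisymm ?_ ?_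
    · exact (pow_dvd_pow_iff hϖ.ne_zero hϖ.not_isUnit).mp h2.dvd
    · exact (pow_dvd_pow_iff hϖ.ne_zero hϖ.not_isUnit).mp h2.symm.dvd

variable [HenselianLocalRing B] [Finite (ResidueField B)] [Finite G] [FaithfulSMul G B]
  (k : Type*) [Field k] [Algebra (ZMod p) k] [FiniteDimensional (ZMod p) k]
  [Algebra k (ResidueField B)] [FiniteDimensional k (ResidueField B)]
  [SMulCommClass G k (ResidueField B)]
  (s : G ⧸ (MulSemiringAction.toRingAut G (ResidueField B)).ker →* G)
  (hs : (QuotientGroup.mk' (MulSemiringAction.toRingAut G (ResidueField B)).ker).comp s =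
    MonoidHom.id _) {d : ℕ}
  (hd : Nat.card (MulSemiringAction.toRingAut G (ResidueField B)).ker = d) (hpd : ¬ p ∣ d)
  (hcard : Nat.card G = d * Module.finrank k (ResidueField B))
  {M : Type*} [AddCommGroup M] [Module (ZMod p)[G] M] (π : Bˣ →* Multiplicative M)
  (hπ : ∀ g u, (π (g • u)).toAdd = MonoidAlgebra.of (ZMod p) G g • (π u).toAdd)
  (hker : ∀ u, π u = 1 ↔ ∃ x : Bˣ, x ^ p = u)
  {N : Type*} [AddCommGroup N] [Module (ZMod p)[G] N] (τ : ZMod p →+ N)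
  (hτ : Function.Bijective τ) (hτG : ∀ (g : G) (n : ℕ), g • ζ = ζ ^ n →
    ∀ a, MonoidAlgebra.of (ZMod p) G g • τ a = τ (n * a))
  {X : Type*} [AddCommGroup X] [Module (ZMod p)[G] X] (ω : X →+ k[G]) (hω : Function.Bijective ω)
  (hωG : ∀ g x, ω (MonoidAlgebra.of (ZMod p) G g • x) = MonoidAlgebra.of k G g * ω x)

include hζ hs hd hpd hcard hker hτ hτG hω hωG

/-- The structure of the principal units modulo `p`-th powers. -/
theorem exists_imageFiltration_one_equiv {c : ℕ}
    (hc : ∀ ϖ : B, Irreducible ϖ → Associated (p : B) (ϖ ^ (c * d))) :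
    ∃ (ϖ : B) (χ : G → B) (hχ : ∀ g, g • ϖ = χ g * ϖ), Irreducible ϖ ∧
      Nonempty (imageFiltration hχ π hπ 1 ≃ₗ[(ZMod p)[G]] N × (Fin c → X)) := by
  have hexχ (ϖ : B) (hϖ : Irreducible ϖ) : ∃ χ : G → B, (∀ g, g • ϖ = χ g * ϖ) ∧
      ∀ g, residue B (χ g) ≠ 0 := by
    have h (g : G) : Associated ϖ (g • ϖ) :=
      IsDiscreteValuationRing.associated_of_irreducible B hϖ
        ((MulEquiv.irreducible_iff (MulSemiringAction.toRingEquiv G B g)).mpr hϖ)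
    choose u hu using h
    refine ⟨fun g => u g, fun g => by rw [← hu, mul_comm], fun g => ?_⟩
    rw [residue_ne_zero_iff_isUnit]
    exact (u g).isUnit
  -- With this uniformizer `χ` is trivial on the section, as the block argument requires.
  obtain ⟨ϖ, hϖ, hsϖ⟩ : ∃ ϖ : B, Irreducible ϖ ∧ ∀ q, s q • ϖ = ϖ := by
    obtain ⟨ϖ, hϖ⟩ := IsDiscreteValuationRing.exists_irreducible B
    obtain ⟨χ, hχ, hχ0⟩ := hexχ ϖ hϖ
    exact exists_irreducible_smul_section_eq hϖ hχ hχ0 s hs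
  obtain ⟨χ, hχ, hχ0⟩ := hexχ ϖ hϖ
  obtain ⟨e, he0, he, hed⟩ := exists_associated_primitiveRoot_sub_one hζ hϖ (hc ϖ hϖ)
  have hd0 : 0 < d := Nat.pos_of_ne_zero fun h => hpd (h ▸ dvd_zero p)
  have hχs (q) : residue B (χ (s q)) = 1 := by
    have h := hχ (s q)
    rw [hsϖ, eq_comm, mul_eq_right₀ hϖ.ne_zero] at h
    rw [h, map_one]
  have hχt : ∀ t ∈ (MulSemiringAction.toRingAut G (ResidueField B)).ker,
      residue B (χ t) = 1 → t = 1 := by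
    intro t ht
    refine eq_one_of_tame hϖ hχ (m := d) ?_ ?_ fun x => ?_
    · rw [← hd]
      exact congrArg Subtype.val (pow_card_eq_one' (x := (⟨t, ht⟩ :
        (MulSemiringAction.toRingAut G (ResidueField B)).ker)))
    · rwa [Ne, CharP.cast_eq_zero_iff (ResidueField B) p]
    · exact congrArg (fun f : ResidueField B ≃+* ResidueField B => f x) (MonoidHom.mem_ker.mp ht)
  have hblock (a : ℕ) := exists_block_equiv p k hϖ.ne_zero hχ s hs hd hχs hχt hχ0 hcard a
  -- A block may start at any level, so every piece is a direct summand of a free module.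
  have (i : ℕ) : Module.Projective (ZMod p)[G] (gradedModule p hϖ.ne_zero hχ i) := by
    obtain ⟨Φ, hΦ, hΦG⟩ := hblock i
    exact projective_gradedModule p k hϖ.ne_zero hχ hd0 Φ hΦ hΦG
  refine ⟨ϖ, χ, hχ, hϖ, ?_⟩
  obtain ⟨f⟩ := nonempty_imageFiltration_one_equiv hζ hϖ hχ he0 he π hπ hker τ hτ hτG hed
  have hX (a : Fin c) : Nonempty (((b : Fin d) → gradedModule p hϖ.ne_zero hχ (e + d * a + b))
      ≃ₗ[(ZMod p)[G]] X) := by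
    obtain ⟨Φ, hΦ, hΦG⟩ := hblock (e + d * a)
    exact ⟨(linearEquivOfEquivariant (p := p) (G := G) (Φ.comp ω)
      (fun g x => (congrArg Φ (hωG g x)).trans (hΦG g (ω x))) (hΦ.comp hω)).symm⟩
  exact ⟨f.trans (LinearEquiv.prodCongr (LinearEquiv.refl _ _)
    (LinearEquiv.piCongrRight fun a => (hX a).some))⟩

end Abstract

/-! ### Return to the field `L`: principal units and roots of unity. -/

section Ambient

variable (p : ℕ) [Fact p.Prime]
  (K : Type*) [Field K] [Algebra ℚ_[p] K]
  (L : Type*) [Field L] [Algebra ℚ_[p] L] [FiniteDimensional ℚ_[p] L]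
  [Algebra K L] [IsScalarTower ℚ_[p] K L]

variable {L} in
lemma mem_integers_of_pow_mem {x : L} {n : ℕ} (hn : n ≠ 0) (h : x ^ n ∈ integers p L) :
    x ∈ integers p L := by
  rw [← ValuationSubring.valuation_le_one_iff, map_pow, pow_le_one_iff hn] at h
  rwa [← ValuationSubring.valuation_le_one_iff]

instance : Module (ZMod p) (Additive (UnitsModPow p L)) :=
  AddCommGroup.zmodModule fun (x : Additive (UnitsModPow p L)) => by
    obtain ⟨z, hz⟩ := QuotientGroup.mk_surjective x.toMul
    refine congrArg Additive.ofMul (?_ : x.toMul ^ p = 1)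
    rw [← hz]
    exact (QuotientGroup.eq_one_iff _).mpr ⟨z, rfl⟩

/-- The `𝔽_p[G]`-module `Lˣ / (Lˣ)^p`. -/
abbrev UnitsModPowModule : Type _ := (zmodRep p Gal(L/K) (UnitsModPow p L)).asModule

/-- The homomorphism from the units of the ring of integers to `Lˣ / (Lˣ)^p`. -/
def unitsModPow : (integers p L)ˣ →* Multiplicative (UnitsModPowModule p K L) where
  toFun u := Multiplicative.ofAdd ((zmodRep p Gal(L/K) (UnitsModPow p L)).asModuleEquiv.symm
    (Additive.ofMul (QuotientGroup.mk (Units.map (integers p L).subtype.toMonoidHom u))))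
  map_one' := rfl
  map_mul' _ _ := rfl

lemma unitsModPow_smul (g : Gal(L/K)) (u : (integers p L)ˣ) :
    (unitsModPow p K L (g • u)).toAdd =
      MonoidAlgebra.of (ZMod p) Gal(L/K) g • (unitsModPow p K L u).toAdd := by
  rw [of_smul_asModule]
  rfl

omit [Algebra ℚ_[p] K] [IsScalarTower ℚ_[p] K L] in
-- A `p`-th root in `L` of an integral unit is itself an integral unit.
lemma unitsModPow_eq_one_iff (u : (integers p L)ˣ) :
    unitsModPow p K L u = 1 ↔ ∃ x : (integers p L)ˣ, x ^ p = u := by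
  have hp0 := (Fact.out : p.Prime).ne_zero
  have h1 : unitsModPow p K L u = 1 ↔
      (QuotientGroup.mk (Units.map (integers p L).subtype.toMonoidHom u) : UnitsModPow p L) = 1 :=
    Iff.rfl
  rw [h1, QuotientGroup.eq_one_iff]
  constructor
  · rintro ⟨y, hy⟩
    have hy : (y : L) ^ p = (u : integers p L) := congrArg Units.val hy
    have hmem : (y : L) ∈ integers p L :=
      mem_integers_of_pow_mem p hp0 (hy ▸ (u : integers p L).2)
    have hyu : (⟨y, hmem⟩ : integers p L) ^ p = u := Subtype.ext hy
    obtain ⟨x, hx⟩ := (isUnit_pow_iff hp0).mp (hyu ▸ u.isUnit)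
    exact ⟨x, Units.ext (by rw [Units.val_pow_eq_pow_val, hx, hyu])⟩
  · rintro ⟨x, rfl⟩
    exact ⟨Units.map (integers p L).subtype.toMonoidHom x, (map_pow _ x p).symm⟩

lemma nonempty_principalUnitsModule_equiv {ϖ : integers p L} (hϖ : Irreducible ϖ)
    {χ : Gal(L/K) → integers p L} (hχ : ∀ g, g • ϖ = χ g * ϖ) :
    Nonempty (PrincipalUnitsModule p K L ≃ₗ[(ZMod p)[Gal(L/K)]]
      imageFiltration hχ (unitsModPow p K L) (unitsModPow_smul p K L) 1) := by
  let f : PrincipalUnitsModule p K L →+ UnitsModPowModule p K L :=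
    MonoidHom.toAdditive (principalUnitsBar p L).subtype
  have hf (g : Gal(L/K)) (x) : f (MonoidAlgebra.of (ZMod p) Gal(L/K) g • x) =
      MonoidAlgebra.of (ZMod p) Gal(L/K) g • f x := by
    rw [of_smul_asModule, of_smul_asModule]
    rfl
  have hinj : Function.Injective (linearMapOfEquivariant f hf) :=
    fun x y h => Subtype.val_injective h
  have hmem (u : (integers p L)ˣ) : u ∈ unitFiltration ϖ 1 ↔
      Units.map (integers p L).subtype.toMonoidHom u ∈ (integers p L).principalUnitGroup := by
    rw [mem_unitFiltration, pow_one, ← Ideal.mem_span_singleton, ← hϖ.maximalIdeal_eq,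
      ValuationSubring.mem_principalUnitGroup_iff, ValuationSubring.valuation_lt_one_iff]
    rfl
  refine ⟨(LinearEquiv.ofInjective _ hinj).trans (LinearEquiv.ofEq _ _ (le_antisymm ?_ ?_))⟩
  · rintro _ ⟨⟨_, z, hz, rfl⟩, rfl⟩
    let u : (integers p L)ˣ := (integers p L).unitGroupMulEquiv
      ⟨z, (integers p L).principal_units_le_units hz⟩
    have hu : Units.map (integers p L).subtype.toMonoidHom u = z := Units.ext rfl
    exact ⟨u, (hmem u).mpr (hu ▸ hz), congrArg (QuotientGroup.mk : Lˣ → UnitsModPow p L) hu⟩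
  · rintro _ ⟨u, hu, rfl⟩
    exact ⟨⟨_, _, (hmem u).mp hu, rfl⟩, rfl⟩

end Ambient

section Torsion

variable (p : ℕ) [Fact p.Prime]
  (K : Type*) [Field K] [Algebra ℚ_[p] K]
  (L : Type*) [Field L] [Algebra ℚ_[p] L] [FiniteDimensional ℚ_[p] L]
  [Algebra K L] [IsScalarTower ℚ_[p] K L] (htors : Nat.card (pTorsion p L) = p)

include htors

/-- A group of order `p` is generated by any nontrivial element `ζ`, and `τ a = ζ ^ a`. -/
lemma exists_primitiveRoot_torsion : ∃ ζ : integers p L, IsPrimitiveRoot ζ p ∧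
    ∃ τ : ZMod p →+ TorsionModule p K L, Function.Bijective τ ∧
      ∀ (g : Gal(L/K)) (n : ℕ), g • ζ = ζ ^ n →
        ∀ a, MonoidAlgebra.of (ZMod p) Gal(L/K) g • τ a = τ (n * a) := by
  have hp : p.Prime := Fact.out
  have : Finite (pTorsion p L) := Nat.finite_of_card_ne_zero (by rw [htors]; exact hp.ne_zero)
  have : Nontrivial (pTorsion p L) :=
    Finite.one_lt_card_iff_nontrivial.mp (by rw [htors]; exact hp.one_lt)
  obtain ⟨z, hz⟩ := exists_ne (1 : pTorsion p L)
  have hzp : ((z : Lˣ) : L) ^ p = 1 := congrArg Units.val z.2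
  have hmem : ((z : Lˣ) : L) ∈ integers p L :=
    mem_integers_of_pow_mem p hp.ne_zero (hzp ▸ one_mem _)
  refine ⟨⟨_, hmem⟩, ?_, ?_⟩
  · refine IsPrimitiveRoot.iff_orderOf.mpr (orderOf_eq_prime (Subtype.ext hzp) fun h => hz ?_)
    exact Subtype.ext (Units.ext (congrArg Subtype.val h))
  · let T := LinearMap.toSpanSingleton (ZMod p) (Additive (pTorsion p L)) (Additive.ofMul z)
    have hinj : Function.Injective T := by
      refine smul_left_injective (ZMod p) (m := Additive.ofMul z) fun h => hz ?_
      exact congrArg Additive.toMul h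
    refine ⟨((zmodRep p Gal(L/K) (pTorsion p L)).asModuleEquiv.symm.toLinearMap.comp
      T).toAddMonoidHom, ?_, fun g n h a => ?_⟩
    · exact (Nat.bijective_iff_injective_and_card T).mpr ⟨hinj, by
        rw [Nat.card_zmod]; exact htors.symm⟩
    · rw [of_smul_asModule]
      refine congrArg (zmodRep p Gal(L/K) (pTorsion p L)).asModuleEquiv.symm ?_
      have h1 : zmodRep p Gal(L/K) (pTorsion p L) g (Additive.ofMul z) =
          n • Additive.ofMul z :=
        congrArg Additive.ofMul (Subtype.ext (Units.ext (congrArg Subtype.val h)) :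
          g • z = z ^ n)
      change zmodRep p Gal(L/K) (pTorsion p L) g (a • Additive.ofMul z) =
        (n * a : ZMod p) • Additive.ofMul z
      rw [map_smul, h1, mul_comm, mul_smul, Nat.cast_smul_eq_nsmul]

end Torsion

/-! ### The second isomorphism, and the conclusion for `L` over `K`. -/

section Final

variable (p : ℕ) [Fact p.Prime]
  (K : Type*) [Field K] [Algebra ℚ_[p] K] [FiniteDimensional ℚ_[p] K]
  (G : Type*) [Group G]

lemma of_smul_residueField_groupAlgebra (g : G) (x : (residueField p K)[G]) :
    MonoidAlgebra.of (ZMod p) G g • x = MonoidAlgebra.of (residueField p K) G g * x := by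
  change MonoidAlgebra.mapRingHom G (algebraMap (ZMod p) (residueField p K))
    (MonoidAlgebra.of (ZMod p) G g) * x = _
  congr 1
  simp

/-- `k[G]` is free over `𝔽_p[G]` of rank `[k : 𝔽_p]`, and `e_K [k : 𝔽_p] = [K : ℚ_p]`. -/
lemma nonempty_residueField_groupAlgebra_equiv :
    Nonempty ((Fin (ramificationIndex p ℚ_[p] K) → (residueField p K)[G]) ≃ₗ[(ZMod p)[G]]
      (Fin (Module.finrank ℚ_[p] K) → (ZMod p)[G])) := by
  have : FiniteDimensional (ZMod p) (residueField p K) := Module.Finite.of_finite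
  let n := Module.finrank (ZMod p) (residueField p K)
  obtain ⟨Ψ, hΨ, hΨG⟩ := exists_groupAlgebra_equiv (G := G)
    (Module.finBasis (ZMod p) (residueField p K))
  let f : (Fin n → (ZMod p)[G]) ≃ₗ[(ZMod p)[G]] (residueField p K)[G] :=
    linearEquivOfEquivariant (p := p) (G := G) Ψ (fun g x => (hΨG g x).trans
      (of_smul_residueField_groupAlgebra p K G g (Ψ x)).symm) hΨ
  let σ : Fin (ramificationIndex p ℚ_[p] K) × Fin n ≃ Fin (Module.finrank ℚ_[p] K) :=
    finProdFinEquiv.trans (finCongr (finrank_residueField_padic p K))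
  exact ⟨((LinearEquiv.piCongrRight fun _ => f.symm).trans
    (LinearEquiv.curry (ZMod p)[G] (ZMod p)[G] _ _).symm).trans
      (LinearEquiv.funCongrLeft (ZMod p)[G] (ZMod p)[G] σ.symm)⟩

end Final

section Residue

variable (p : ℕ) [Fact p.Prime]
  (K : Type*) [Field K] [Algebra ℚ_[p] K] [FiniteDimensional ℚ_[p] K]
  (L : Type*) [Field L] [Algebra ℚ_[p] L] [FiniteDimensional ℚ_[p] L]
  [Algebra K L] [IsScalarTower ℚ_[p] K L]

/-- The extension of residue fields. -/
abbrev residueFieldAlgebra : Algebra (residueField p K) (residueField p L) :=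
  (ResidueField.map (integersMap p K L)).toAlgebra

attribute [local instance] residueFieldAlgebra

lemma smulCommClass_residueField :
    SMulCommClass Gal(L/K) (residueField p K) (residueField p L) where
  smul_comm g a x := by
    obtain ⟨a, rfl⟩ := residue_surjective a
    have ha : g • integersMap p K L a = integersMap p K L a :=
      Subtype.ext (g.commutes (a : K))
    rw [Algebra.smul_def, Algebra.smul_def, smul_mul']
    congr 1
    change g • residue _ (integersMap p K L a) = residue _ (integersMap p K L a)
    rw [← ResidueField.residue_smul, ha]

omit [FiniteDimensional ℚ_[p] K] in
lemma faithfulSMul_integers : FaithfulSMul Gal(L/K) (integers p L) where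
  eq_of_smul_eq_smul {g h} hgh := by
    refine AlgEquiv.ext fun x => ?_
    obtain ⟨a, b, -, rfl⟩ := IsFractionRing.div_surjective (A := integers p L) x
    rw [map_div₀, map_div₀]
    exact congrArg₂ (· / ·) (congrArg Subtype.val (hgh a)) (congrArg Subtype.val (hgh b))

lemma card_galois_eq_mul [IsGalois K L] : Nat.card Gal(L/K) =
    ramificationIndex p K L * Module.finrank (residueField p K) (residueField p L) := by
  have := finiteDimensional_of_padic p K L
  have : FiniteDimensional (residueField p K) (residueField p L) := Module.Finite.of_finite
  rw [IsGalois.card_aut_eq_finrank, ← ramificationIndex_mul_inertiaDeg p K L]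
  congr 1
  refine Nat.pow_right_injective (Finite.one_lt_card (α := residueField p K)) ?_
  exact (card_residueField_pow p K L).trans Module.natCard_eq_pow_finrank

/-- The image of the principal units in `Lˣ / (Lˣ)^p` for a split tame extension containing the
`p`-th roots of unity. -/
theorem nonempty_principalUnitsModule_equiv_prod [IsGalois K L] (htame : IsTamelyRamified p K L)
    (hsplit : IsSplit p K L) (htors : Nat.card (pTorsion p L) = p) :
    Nonempty (PrincipalUnitsModule p K L ≃ₗ[(ZMod p)[Gal(L/K)]] TorsionModule p K L ×
      (Fin (ramificationIndex p ℚ_[p] K) → (residueField p K)[Gal(L/K)])) := by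
  have := finiteDimensional_of_padic p K L
  have : FiniteDimensional (ZMod p) (residueField p K) := Module.Finite.of_finite
  have : FiniteDimensional (residueField p K) (residueField p L) :=
    Module.Finite.of_finite
  have := smulCommClass_residueField p K L
  have := faithfulSMul_integers p K L
  obtain ⟨s, hs⟩ := hsplit
  obtain ⟨ζ, hζ, τ, hτ, hτG⟩ := exists_primitiveRoot_torsion p K L htors
  obtain ⟨ϖ, χ, hχ, hϖ, ⟨f⟩⟩ := exists_imageFiltration_one_equiv hζ
    (residueField p K) s hs (card_inertiaSubgroup p K L) htame
    (card_galois_eq_mul p K L) (unitsModPow p K L)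
    (unitsModPow_smul p K L) (unitsModPow_eq_one_iff p K L) τ hτ hτG
    (AddMonoidHom.id (residueField p K)[Gal(L/K)]) Function.bijective_id
    (of_smul_residueField_groupAlgebra p K Gal(L/K))
    -- The valuation of `p` in `L` is `e_K` times the ramification index of `L` over `K`: this is
    -- the number of blocks times their length.
    (c := ramificationIndex p ℚ_[p] K) (fun ϖ hϖ => by
      rw [← ramificationIndex_tower]
      exact associated_natCast p L hϖ)
  obtain ⟨g⟩ := nonempty_principalUnitsModule_equiv p K L hϖ hχ
  exact ⟨g.trans f⟩

end Residue

end LittleGalois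

end

theorem mainTheorem1 (p : ℕ) [Fact p.Prime]
    (K : Type*) [Field K] [Algebra ℚ_[p] K] [FiniteDimensional ℚ_[p] K]
    (L : Type*) [Field L] [Algebra ℚ_[p] L] [FiniteDimensional ℚ_[p] L]
    [Algebra K L] [IsScalarTower ℚ_[p] K L] [IsGalois K L]
    (htame : LittleGalois.IsTamelyRamified p K L)
    (hsplit : LittleGalois.IsSplit p K L)
    (htors : Nat.card (LittleGalois.pTorsion p L) = p) :
    Nonempty (LittleGalois.PrincipalUnitsModule p K L ≃ₗ[(ZMod p)[Gal(L/K)]]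
      LittleGalois.TorsionModule p K L ×
        (Fin (LittleGalois.ramificationIndex p ℚ_[p] K) →
          (LittleGalois.residueField p K)[Gal(L/K)])) ∧
    Nonempty ((LittleGalois.TorsionModule p K L ×
        (Fin (LittleGalois.ramificationIndex p ℚ_[p] K) →
          (LittleGalois.residueField p K)[Gal(L/K)])) ≃ₗ[(ZMod p)[Gal(L/K)]]
      LittleGalois.TorsionModule p K L ×
        (Fin (Module.finrank ℚ_[p] K) → (ZMod p)[Gal(L/K)])) := by
  obtain ⟨f⟩ := LittleGalois.nonempty_residueField_groupAlgebra_equiv p K Gal(L/K)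
  exact ⟨LittleGalois.nonempty_principalUnitsModule_equiv_prod p K L htame hsplit htors,
    ⟨(LinearEquiv.refl _ _).prodCongr f⟩⟩
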